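/- A fuzzy graph $G=(V,E^+,E^0)$ consists of a finite vertex set $V$ and disjoint sets $E^+$ of real edges and $E^0$ of fuzzy edges; the remaining pairs of distinct vertices are the nonedges. In Correlation Clustering one is given a fuzzy graph, weights $\omega:\binom V2\to\mathbb Z_{\ge 0}$ that are $0$ exactly on the fuzzy edges, and an integer $k\ge 0$, and asks whether $V$ has a partition of cost at most $k$, where the cost is the total weight of the real edges between different parts and of the nonedges inside parts. Let $d$ be the fuzzy degeneracy of the input, that is, the smallest $d$ such that $V$ has an ordering in which every vertex has at most $d$ later neighbours in the graph $(V,E^0)$. Theorem. Correlation Clustering, parameterized by $k+d$, admits a polynomial kernel with at most $30k^3d$ vertices for $k,d\ge 1$. That is, there are a polynomial $g$ and an algorithm that maps each instance $(G,\omega,k)$, in time polynomial in its binary encoding length, to an equivalent instance $(G',\omega',k')$ such that the encoding length of $(G',\omega',k')$ plus its parameter $k'+d'$, where $d'$ is the fuzzy degeneracy of $G'$, is at most $g(k+d)$; moreover, if $k\ge 1$ and $d\ge 1$, then $G'$ has at most $30k^3d$ vertices. -/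

import Mathlib

/-! ### Random access machines with unit-cost addition, subtraction and halving -/

namespace RAM

/-- The memory: finitely many banks (a program mentions only finitely many of them), each an array
of natural numbers.  `s b i` is the content of cell `i` of bank `b`.  A register is a bank of which
only cell `0` is used. -/
abbrev State := ℕ → ℕ → ℕ

/-- Expressions: constants, memory access (with computed address), addition, truncated subtraction
and halving.  There is no multiplication, so that one operation lengthens the binary representation
of the largest number in use by at most one bit, and the unit-cost measure below is polynomially
related to the running time of Turing machines. -/
inductive Expr where
  | lit (n : ℕ)
  | cell (b : ℕ) (i : Expr)
  | add (e₁ e₂ : Expr)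
  | sub (e₁ e₂ : Expr)
  | half (e : Expr)

/-- The value of an expression. -/
def Expr.eval (s : State) : Expr → ℕ
  | .lit n => n
  | .cell b i => s b (i.eval s)
  | .add e₁ e₂ => e₁.eval s + e₂.eval s
  | .sub e₁ e₂ => e₁.eval s - e₂.eval s
  | .half e => e.eval s / 2

/-- The number of elementary operations performed when an expression is evaluated. -/
def Expr.cost : Expr → ℕ
  | .lit _ => 1
  | .cell _ i => i.cost + 1
  | .add e₁ e₂ => e₁.cost + e₂.cost + 1
  | .sub e₁ e₂ => e₁.cost + e₂.cost + 1
  | .half e => e.cost + 1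

/-- Programs. `assign b i e` stores the value of `e` in cell `i` of bank `b`; `branch` and `loop`
test whether an expression is nonzero. -/
inductive Prog where
  | skip
  | assign (b : ℕ) (i e : Expr)
  | seq (c₁ c₂ : Prog)
  | branch (e : Expr) (c₁ c₂ : Prog)
  | loop (e : Expr) (c : Prog)

/-- Writing the value `x` into cell `i` of bank `b`. -/
def State.write (s : State) (b i x : ℕ) : State :=
  Function.update s b (Function.update (s b) i x)

/-- `Exec c s s' t`: started in the memory state `s`, the program `c` halts in the memory
state `s'` after exactly `t` elementary steps. -/
inductive Exec : Prog → State → State → ℕ → Prop where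
  | skip (s : State) : Exec .skip s s 1
  | assign (b : ℕ) (i e : Expr) (s : State) :
      Exec (.assign b i e) s (s.write b (i.eval s) (e.eval s)) (i.cost + e.cost + 1)
  | seq {c₁ c₂ : Prog} {s s₁ s₂ : State} {t₁ t₂ : ℕ} :
      Exec c₁ s s₁ t₁ → Exec c₂ s₁ s₂ t₂ → Exec (.seq c₁ c₂) s s₂ (t₁ + t₂)
  | branch_true {e : Expr} {c₁ c₂ : Prog} {s s' : State} {t : ℕ} :
      e.eval s ≠ 0 → Exec c₁ s s' t → Exec (.branch e c₁ c₂) s s' (e.cost + 1 + t)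
  | branch_false {e : Expr} {c₁ c₂ : Prog} {s s' : State} {t : ℕ} :
      e.eval s = 0 → Exec c₂ s s' t → Exec (.branch e c₁ c₂) s s' (e.cost + 1 + t)
  | loop_true {e : Expr} {c : Prog} {s s₁ s₂ : State} {t₁ t₂ : ℕ} :
      e.eval s ≠ 0 → Exec c s s₁ t₁ → Exec (.loop e c) s₁ s₂ t₂ →
      Exec (.loop e c) s s₂ (e.cost + 1 + t₁ + t₂)
  | loop_false {e : Expr} {c : Prog} {s : State} :
      e.eval s = 0 → Exec (.loop e c) s s (e.cost + 1)

/-- The initial memory on an input list: bank `0` holds the length of the list in cell `0` and its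
entries in the cells `1, 2, …`; everything else is `0`. -/
def initial (l : List ℕ) : State :=
  fun b i => if b = 0 then (l.length :: l).getD i 0 else 0

/-- The output list in a final memory: bank `1` holds its length in cell `0` and its entries in the
cells `1, 2, …`. -/
def output (s : State) : List ℕ :=
  (List.range (s 1 0)).map fun i => s 1 (i + 1)

/-- The size of a list of natural numbers, written in binary (one extra symbol ends each number). -/
def bitSize (l : List ℕ) : ℕ :=
  (l.map fun x => x.size + 1).sum

/-- `f` is computed by one program whose number of steps is bounded by a polynomial in the binary
size of the input. -/
def PolyTime {α β : Type} (codeIn : α → List ℕ) (codeOut : β → List ℕ) (f : α → β) : Prop :=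
  ∃ (c : Prog) (p : Polynomial ℕ), ∀ a : α, ∃ (s : State) (t : ℕ),
    Exec c (initial (codeIn a)) s t ∧ t ≤ p.eval (bitSize (codeIn a)) ∧
      output s = codeOut (f a)

end RAM

/-! ### Polynomial kernels -/

/-- `f` is a polynomial kernel for the problem with instances `α`, yes-instances `yes`,
parameter `param` and encoding `code`: it is computable in polynomial time, it maps every instance
to an equivalent one, and the encoding size plus the parameter of the new instance are bounded by a
polynomial in the parameter of the given one. -/
def IsPolynomialKernel {α : Type} (code : α → List ℕ) (yes : α → Prop) (param : α → ℕ)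
    (f : α → α) : Prop :=
  RAM.PolyTime code code f ∧
    (∀ a, yes (f a) ↔ yes a) ∧
    ∃ g : Polynomial ℕ, ∀ a, RAM.bitSize (code (f a)) + param (f a) ≤ g.eval (param a)

/-! ### Degeneracy -/

namespace SimpleGraph

variable {V : Type} [Fintype V]

/-- There is an ordering of the vertices such that each vertex has at most `d` neighbours that come
later in the ordering. -/
def HasDegeneracyOrdering (G : SimpleGraph V) (d : ℕ) : Prop :=
  ∃ σ : Fin (Fintype.card V) ≃ V, ∀ i, {j | i < j ∧ G.Adj (σ i) (σ j)}.ncard ≤ d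

/-- The degeneracy of a finite graph (the set is nonempty by the lemma below). -/
noncomputable def degeneracy (G : SimpleGraph V) : ℕ :=
  sInf {d | G.HasDegeneracyOrdering d}

theorem exists_hasDegeneracyOrdering (G : SimpleGraph V) : ∃ d, G.HasDegeneracyOrdering d :=
  ⟨Fintype.card V, (Fintype.equivFin V).symm, fun _ => by
    simpa using Set.ncard_le_card (α := Fin (Fintype.card V)) _⟩

end SimpleGraph

/-! ### Fuzzy graphs and Correlation Clustering -/

/-- A fuzzy graph: a set of real edges and a disjoint set of fuzzy edges. -/
structure FuzzyGraph (V : Type) where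
  real : SimpleGraph V
  fuzzy : SimpleGraph V
  disjoint : ∀ u v, ¬ (real.Adj u v ∧ fuzzy.Adj u v)

/-- A pair of distinct vertices that is neither a real nor a fuzzy edge. -/
def FuzzyGraph.IsNonedge {V : Type} (G : FuzzyGraph V) (u v : V) : Prop :=
  u ≠ v ∧ ¬ G.real.Adj u v ∧ ¬ G.fuzzy.Adj u v

/-- The vertex pair `e` is a (positive or negative) mistake of the clustering `C`. -/
def FuzzyGraph.IsMistake {V : Type} [Fintype V] [DecidableEq V] (G : FuzzyGraph V)
    (C : Finpartition (Finset.univ : Finset V)) (e : Sym2 V) : Prop :=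
  ∃ u v, e = s(u, v) ∧
    ((G.real.Adj u v ∧ u ∉ C.part v) ∨ (G.IsNonedge u v ∧ u ∈ C.part v))

open Classical in
/-- The cost of a clustering: the total weight of its mistakes. -/
noncomputable def FuzzyGraph.cost {V : Type} [Fintype V] [DecidableEq V] (G : FuzzyGraph V)
    (weight : Sym2 V → ℕ) (C : Finpartition (Finset.univ : Finset V)) : ℕ :=
  ∑ e : Sym2 V with G.IsMistake C e, weight e

/-- Instances of Correlation Clustering: a fuzzy graph, a weight function on the vertex pairs, which
is zero exactly on the fuzzy edges, and a budget `k`.  The weight of a degenerate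
pair `s(v, v)` is set to `0` and never used. -/
structure CCInstance where
  n : ℕ
  graph : FuzzyGraph (Fin n)
  weight : Sym2 (Fin n) → ℕ
  weight_eq_zero_iff : ∀ u v, weight s(u, v) = 0 ↔ u = v ∨ graph.fuzzy.Adj u v
  k : ℕ

namespace CCInstance

/-- Some clustering has cost at most `k`. -/
def IsYes (I : CCInstance) : Prop :=
  ∃ C : Finpartition (Finset.univ : Finset (Fin I.n)), I.graph.cost I.weight C ≤ I.k

/-- The fuzzy degeneracy: the degeneracy of the graph formed by the fuzzy edges. -/
noncomputable def d (I : CCInstance) : ℕ := I.graph.fuzzy.degeneracy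

/-- The parameter `k + d`. -/
noncomputable def param (I : CCInstance) : ℕ := I.k + I.d

open Classical in
/-- The encoding of an instance: the number of vertices, the budget, the weight matrix and the
adjacency matrix of the real edges, both row by row (the fuzzy edges are the pairs of distinct
vertices of weight `0`). -/
noncomputable def code (I : CCInstance) : List ℕ :=
  I.n :: I.k ::
    (((List.finRange I.n).flatMap fun i => (List.finRange I.n).map fun j => I.weight s(i, j)) ++
     ((List.finRange I.n).flatMap fun i => (List.finRange I.n).map fun j =>
        if I.graph.real.Adj i j then 1 else 0))

end CCInstance

/-! Every mistake has weight at least `1`, so a clustering of cost at most `k` makes at most `k`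
mistakes. It keeps two vertices with more than `k` common real neighbours together, because
otherwise every common neighbour yields a mistake of its own (`common_le_cost`). A component of the
real graph without nonedges is clean: it can form a cluster at cost `0`. The kernel greedily chooses
representatives that pairwise have at most `k` common neighbours, attaches every other vertex to a
representative with which it has more than `k`, drops the clean classes and merges each remaining
class into one vertex. Two classes have total real weight `pos` and total nonedge weight `neg`
between them. The smaller one is unavoidable and is charged to the budget; the difference, capped at
`2k + 1`, is the new weight.

The size bound: the mistakes touch at most `2k` vertices, and every dirty vertex shares a cluster
with a touched one (`Dirty.exists_touched`), so at most `2k` clusters matter. An untouched vertex is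
joined by a real or fuzzy edge to all other vertices of its cluster `P`. Hence two untouched
representatives `u`, `v` in `P` give `|P| ≤ 2 + k + f u + f v`, where `f` is the fuzzy degree inside
`P`. If `P` spans at most `q|P|` fuzzy edges, averaging leaves at most `8q + 2k + 3` untouched
representatives in it (`card_le_of_untouched`). So a yes-instance has at most `2k(8q + 2k + 4)`
dirty representatives. If there are more, or if the unavoidable cost exceeds `k`, a fixed
no-instance is returned.

A suitable `q ≤ d` is found by repeatedly deleting a vertex of minimum fuzzy degree (`PeelInv`).
Polynomial time is proved for an explicit program by a logic of total correctness (`WP`): each loop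
has at most `n` iterations, so the nesting of the loops determines a polynomial time bound. -/

/-! ### A program logic with time bounds. -/

namespace RAM

/-- A polynomial bound for the running time of a program in terms of a bound for the number of
iterations of each of its loops. -/
noncomputable def Prog.timeBound : Prog → Polynomial ℕ
  | .skip => 1
  | .assign _ i e => Polynomial.C (i.cost + e.cost + 1)
  | .seq c₁ c₂ => c₁.timeBound + c₂.timeBound
  | .branch e c₁ c₂ => Polynomial.C (e.cost + 1) + (c₁.timeBound + c₂.timeBound)
  | .loop e c => (Polynomial.X + 1) * (Polynomial.C (e.cost + 1) + c.timeBound)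

/-- The banks that a program may write to. -/
def Prog.writes : Prog → List ℕ
  | .skip => []
  | .assign b _ _ => [b]
  | .seq c₁ c₂ => c₁.writes ++ c₂.writes
  | .branch _ c₁ c₂ => c₁.writes ++ c₂.writes
  | .loop _ c => c.writes

theorem State.write_apply (s : State) (b i x b' i' : ℕ) :
    s.write b i x b' i' = if b' = b ∧ i' = i then x else s b' i' := by
  unfold State.write Function.update
  by_cases h : b' = b <;> by_cases h' : i' = i <;> simp [h, h']

theorem State.write_same (s : State) (b i x i' : ℕ) :
    s.write b i x b i' = if i' = i then x else s b i' := by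
  simp [State.write_apply]

theorem State.write_of_ne (s : State) {b b' : ℕ} (i x : ℕ) (h : b' ≠ b) :
    s.write b i x b' = s b' := by
  simp [State.write, Function.update_of_ne h]

theorem Exec.frame {c : Prog} {s s' : State} {t : ℕ} (h : Exec c s s' t) :
    ∀ b, b ∉ c.writes → s' b = s b := by
  induction h with
  | skip => intros; rfl
  | assign b i e s =>
    intro b' hb
    exact State.write_of_ne _ _ _ (by simpa [Prog.writes] using hb)
  | seq _ _ ih₁ ih₂ =>
    intro b hb
    simp only [Prog.writes, List.mem_append, not_or] at hb
    rw [ih₂ b hb.2, ih₁ b hb.1]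
  | branch_true _ _ ih =>
    intro b hb
    simp only [Prog.writes, List.mem_append, not_or] at hb
    exact ih b hb.1
  | branch_false _ _ ih =>
    intro b hb
    simp only [Prog.writes, List.mem_append, not_or] at hb
    exact ih b hb.2
  | loop_true _ _ _ ih₁ ih₂ =>
    intro b hb
    rw [ih₂ b hb, ih₁ b hb]
  | loop_false => intros; rfl

/-- The program `c`, started in `s`, halts in a state with property `Q`, within the time that is
allowed if each of its loops has at most `N` iterations. -/
def WP (N : ℕ) (c : Prog) (Q : State → Prop) (s : State) : Prop :=
  ∃ s' t, Exec c s s' t ∧ t ≤ c.timeBound.eval N ∧ Q s'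

/-- The new postcondition may use that banks outside `writes` are unchanged. This is how facts about
memory are carried from one subprogram to the next; for concrete programs `decide` checks the side
conditions. -/
theorem WP.mono {N : ℕ} {c : Prog} {Q Q' : State → Prop} {s : State} (h : WP N c Q s)
    (hQ : ∀ s', (∀ b, b ∉ c.writes → s' b = s b) → Q s' → Q' s') : WP N c Q' s := by
  obtain ⟨s', t, he, ht, hq⟩ := h
  exact ⟨s', t, he, ht, hQ s' he.frame hq⟩

theorem WP.skip {N : ℕ} {Q : State → Prop} {s : State} (h : Q s) : WP N .skip Q s :=
  ⟨s, 1, .skip s, by simp [Prog.timeBound], h⟩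

theorem WP.assign {N : ℕ} {b : ℕ} {i e : Expr} {Q : State → Prop} {s : State}
    (h : Q (s.write b (i.eval s) (e.eval s))) : WP N (.assign b i e) Q s :=
  ⟨_, _, .assign b i e s, by simp [Prog.timeBound], h⟩

theorem WP.seq {N : ℕ} {c₁ c₂ : Prog} {Q : State → Prop} {s : State}
    (h : WP N c₁ (WP N c₂ Q) s) : WP N (.seq c₁ c₂) Q s := by
  obtain ⟨s₁, t₁, he₁, ht₁, s₂, t₂, he₂, ht₂, hq⟩ := h
  refine ⟨s₂, _, .seq he₁ he₂, ?_, hq⟩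
  simp only [Prog.timeBound, Polynomial.eval_add]
  omega

theorem WP.branch {N : ℕ} {e : Expr} {c₁ c₂ : Prog} {Q : State → Prop} {s : State}
    (h₁ : e.eval s ≠ 0 → WP N c₁ Q s) (h₂ : e.eval s = 0 → WP N c₂ Q s) :
    WP N (.branch e c₁ c₂) Q s := by
  by_cases h : e.eval s = 0
  · obtain ⟨s', t, he, ht, hq⟩ := h₂ h
    refine ⟨s', _, .branch_false h he, ?_, hq⟩
    simp only [Prog.timeBound, Polynomial.eval_add, Polynomial.eval_C]
    omega
  · obtain ⟨s', t, he, ht, hq⟩ := h₁ h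
    refine ⟨s', _, .branch_true h he, ?_, hq⟩
    simp only [Prog.timeBound, Polynomial.eval_add, Polynomial.eval_C]
    omega

/-- The content of a register. -/
abbrev Expr.reg (b : ℕ) : Expr := .cell b (.lit 0)

/-- Assignment to a register. -/
abbrev Prog.set (b : ℕ) (e : Expr) : Prog := .assign b (.lit 0) e

/-- Execute `c` with the register `i` running through the numbers below `e`. -/
def Prog.forLoop (i : ℕ) (e : Expr) (c : Prog) : Prog :=
  .seq (.set i (.lit 0))
    (.loop (.sub e (.reg i)) (.seq c (.set i (.add (.reg i) (.lit 1)))))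

/-- The counter is incremented after the body has established the invariant, so the invariant has to
be insensitive to it (`hInv`). By `he` the limit keeps its value `n` while the loop runs. -/
theorem WP.forLoop {N : ℕ} {i : ℕ} {e : Expr} {c : Prog} {Q : State → Prop} {s : State}
    (n : ℕ) (Inv : ℕ → State → Prop) (hn : n ≤ N) (hi : i ∉ c.writes)
    (he : ∀ s', (∀ b, b ∉ i :: c.writes → s' b = s b) → e.eval s' = n)
    (hInv : ∀ j s x, Inv j s → Inv j (s.write i 0 x))
    (h0 : Inv 0 s)
    (hstep : ∀ j s', j < n → s' i 0 = j → (∀ b, b ∉ i :: c.writes → s' b = s b) → Inv j s' →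
      WP N c (Inv (j + 1)) s')
    (hQ : ∀ s', (∀ b, b ∉ i :: c.writes → s' b = s b) → Inv n s' → Q s') :
    WP N (.forLoop i e c) Q s := by
  set T := (Prog.seq c (.set i (.add (.reg i) (.lit 1)))).timeBound.eval N with hT
  set E := (Expr.sub e (.reg i)).cost + 1 with hE
  -- Induction on the number `r` of remaining iterations; each costs at most `E + T`, and the final
  -- failing test costs `E`.
  have key : ∀ r j s', j + r = n → s' i 0 = j → (∀ b, b ∉ i :: c.writes → s' b = s b) →
      Inv j s' → ∃ s'' t, Exec (.loop (.sub e (.reg i))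
        (.seq c (.set i (.add (.reg i) (.lit 1))))) s' s'' t ∧ t ≤ (E + T) * r + E ∧
        (∀ b, b ∉ i :: c.writes → s'' b = s b) ∧ Inv n s'' := by
    intro r
    induction r with
    | zero =>
      intro j s' hj hs hf hI
      refine ⟨s', _, .loop_false ?_, by simp [hE], hf, by simpa [← hj] using hI⟩
      simp [Expr.eval, he s' hf, hs, ← hj]
    | succ r ih =>
      intro j s' hj hs hf hI
      obtain ⟨s₁, t₁, he₁, ht₁, hI₁⟩ := hstep j s' (by omega) hs hf hI
      have hs₁ : s₁ i 0 = j := by rw [he₁.frame i hi, hs]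
      have hx : Exec (.seq c (.set i (.add (.reg i) (.lit 1)))) s' (s₁.write i 0 (j + 1)) _ :=
        .seq he₁ (by simpa [Expr.eval, hs₁] using
          Exec.assign i (.lit 0) (.add (.reg i) (.lit 1)) s₁)
      obtain ⟨s₂, t₂, he₂, ht₂, hf₂, hI₂⟩ := ih (j + 1) (s₁.write i 0 (j + 1)) (by omega)
        (by simp [State.write_same])
        (by
          intro b hb
          have hb' := hb
          simp only [List.mem_cons, not_or] at hb'
          rw [State.write_of_ne _ _ _ hb'.1, he₁.frame b hb'.2, hf b hb])
        (hInv _ _ _ hI₁)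
      refine ⟨s₂, _, .loop_true ?_ hx he₂, ?_, hf₂, hI₂⟩
      · simp only [Expr.eval, he s' hf, hs]
        omega
      · simp only [Prog.timeBound, Polynomial.eval_add, Polynomial.eval_C, hT] at ht₁ ht₂ ⊢
        simp only [Expr.cost] at *
        rw [mul_add]
        omega
  obtain ⟨s', t, hx, ht, hf, hI⟩ := key n 0 (s.write i 0 0) (by omega)
    (by simp [State.write_same])
    (by
      intro b hb
      simp only [List.mem_cons, not_or] at hb
      exact State.write_of_ne _ _ _ hb.1) (hInv _ _ _ h0)
  refine ⟨s', _, .seq (.assign _ _ _ _) hx, ?_, hQ s' hf hI⟩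
  have h1 : (E + T) * n ≤ (E + T) * N := Nat.mul_le_mul_left _ hn
  have h2 : (Prog.forLoop i e c).timeBound.eval N = 3 + (N + 1) * (E + T) := by
    simp [Prog.forLoop, Prog.timeBound, hE, hT, Expr.cost]
  rw [h2]
  simp only [Expr.cost]
  nlinarith

/-- A loop that accumulates a sum in the register `acc`. -/
theorem WP.sumLoop {N : ℕ} {i acc : ℕ} {e : Expr} {c : Prog} {Q : State → Prop} {s : State}
    {n : ℕ} (g : Fin n → ℕ) (hn : n ≤ N) (hi : i ∉ c.writes) (hacc : acc ≠ i)
    (he : ∀ s', (∀ b, b ∉ i :: c.writes → s' b = s b) → e.eval s' = n)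
    (hstep : ∀ (x : Fin n) (s' : State), s' i 0 = x.val → (∀ b, b ∉ i :: c.writes → s' b = s b) →
      WP N c (fun s'' => s'' acc 0 = s' acc 0 + g x) s')
    (hQ : ∀ s', (∀ b, b ∉ i :: c.writes → s' b = s b) → s' acc 0 = s acc 0 + ∑ x, g x → Q s') :
    WP N (.forLoop i e c) Q s := by
  refine WP.forLoop n
    (fun j s' => s' acc 0 = s acc 0 + ∑ x : Fin n, if x.val < j then g x else 0) hn hi he
    (fun j s' x h => by rwa [State.write_of_ne _ _ _ hacc]) (by simp) ?_ ?_
  · intro j s' hj hs hf hI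
    refine (hstep ⟨j, hj⟩ s' hs hf).mono fun s'' _ h => ?_
    rw [h, hI, add_assoc]
    congr 1
    rw [show g ⟨j, hj⟩ = ∑ x, if x = ⟨j, hj⟩ then g x else 0 by simp, ← Finset.sum_add_distrib]
    refine Finset.sum_congr rfl fun x _ => ?_
    have : x = ⟨j, hj⟩ ↔ x.val = j := Fin.ext_iff
    by_cases h1 : x.val < j
    · have h2 : x ≠ ⟨j, hj⟩ := fun h => by rw [this] at h; omega
      simp [h1, h2, Nat.lt_succ_of_lt h1]
    · by_cases h2 : x.val = j
      · simp [h2, this]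
      · have : ¬ x.val < j + 1 := by omega
        simp [h1, h2, this, Fin.ext_iff]
  · intro s' hf hI
    exact hQ s' hf (by simpa using hI)

/-! ### Truth values and output. -/

/-- Negation of truth values; every nonzero number counts as true. -/
def Expr.not (e : Expr) : Expr := .sub (.lit 1) e

/-- Conjunction of truth values. -/
def Expr.and (e₁ e₂ : Expr) : Expr := .not (.add (.not e₁) (.not e₂))

/-- The truth value of inequality. -/
def Expr.ne (e₁ e₂ : Expr) : Expr := .add (.sub e₁ e₂) (.sub e₂ e₁)

def Expr.min (e₁ e₂ : Expr) : Expr := .sub e₁ (.sub e₁ e₂)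

theorem Expr.eval_not_ne_zero (e : Expr) (s : State) : e.not.eval s ≠ 0 ↔ ¬ e.eval s ≠ 0 := by
  simp only [Expr.not, Expr.eval]
  omega

theorem Expr.eval_and_ne_zero (e₁ e₂ : Expr) (s : State) :
    (e₁.and e₂).eval s ≠ 0 ↔ e₁.eval s ≠ 0 ∧ e₂.eval s ≠ 0 := by
  simp only [Expr.and, Expr.not, Expr.eval]
  omega

theorem Expr.eval_ne_ne_zero (e₁ e₂ : Expr) (s : State) :
    (e₁.ne e₂).eval s ≠ 0 ↔ e₁.eval s ≠ e₂.eval s := by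
  simp only [Expr.ne, Expr.eval]
  omega

theorem Expr.eval_min (e₁ e₂ : Expr) (s : State) :
    (e₁.min e₂).eval s = Min.min (e₁.eval s) (e₂.eval s) := by
  simp only [Expr.min, Expr.eval]
  omega

/-- The value `1 - x` is always `0` or `1`, so truth values of this form can be summed in order to
count. -/
theorem Expr.eval_not_eq_ite {e : Expr} {s : State} {p : Prop} [Decidable p]
    (h : e.not.eval s ≠ 0 ↔ p) : e.not.eval s = if p then 1 else 0 := by
  simp only [← h, Expr.not, Expr.eval]
  split_ifs <;> omega

theorem Expr.eval_and_eq_ite {e₁ e₂ : Expr} {s : State} {p : Prop} [Decidable p]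
    (h : (e₁.and e₂).eval s ≠ 0 ↔ p) : (e₁.and e₂).eval s = if p then 1 else 0 :=
  Expr.eval_not_eq_ite h

/-- Append the value of an expression to the output. -/
def Prog.push (e : Expr) : Prog :=
  .seq (.assign 1 (.add (.cell 1 (.lit 0)) (.lit 1)) e)
    (.assign 1 (.lit 0) (.add (.cell 1 (.lit 0)) (.lit 1)))

theorem WP.push {N : ℕ} {e : Expr} {Q : State → Prop} {s : State}
    (h : ∀ s', (∀ b, b ≠ 1 → s' b = s b) → output s' = output s ++ [e.eval s] → Q s') :
    WP N (.push e) Q s := by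
  refine WP.seq (WP.assign (WP.assign (h _ ?_ ?_)))
  · intro b hb
    rw [State.write_of_ne _ _ _ hb, State.write_of_ne _ _ _ hb]
  · have h0 : ¬ (0 = s 1 0 + 1) := by omega
    simp only [Expr.eval, output, State.write_same, if_true, h0, if_false, List.range_succ,
      List.map_append, List.map_cons, List.map_nil, Nat.add_eq_zero_iff, one_ne_zero, and_false,
      Nat.add_right_cancel_iff]
    congr 1
    refine List.map_congr_left fun j hj => ?_
    have : j < s 1 0 := List.mem_range.1 hj
    rw [if_neg (by omega)]

def Prog.pushList : List ℕ → Prog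
  | [] => .skip
  | x :: l => .seq (.push (.lit x)) (.pushList l)

theorem WP.pushList {N : ℕ} {Q : State → Prop} (l : List ℕ) {s : State}
    (h : ∀ s', output s' = output s ++ l → Q s') : WP N (.pushList l) Q s := by
  induction l generalizing s with
  | nil => exact WP.skip (h s (by simp))
  | cons x l ih =>
    refine WP.seq (WP.push fun s' _ hs' => ih fun s'' hs'' => h s'' ?_)
    rw [hs'', hs']
    simp [Expr.eval]

/-- A loop that appends a list to the output. -/
theorem WP.outputLoop {N : ℕ} {i : ℕ} {e : Expr} {c : Prog} {Q : State → Prop} {s : State}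
    {n : ℕ} (g : Fin n → List ℕ) (hn : n ≤ N) (hi : i ∉ c.writes) (hi1 : i ≠ 1)
    (he : ∀ s', (∀ b, b ∉ i :: c.writes → s' b = s b) → e.eval s' = n)
    (hstep : ∀ (x : Fin n) (s' : State), s' i 0 = x.val → (∀ b, b ∉ i :: c.writes → s' b = s b) →
      WP N c (fun s'' => output s'' = output s' ++ g x) s')
    (hQ : ∀ s', (∀ b, b ∉ i :: c.writes → s' b = s b) →
      output s' = output s ++ (List.finRange n).flatMap g → Q s') :
    WP N (.forLoop i e c) Q s := by
  refine WP.forLoop n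
    (fun j s' => output s' = output s ++ ((List.finRange n).take j).flatMap g) hn hi he
    (fun j s' x h => by rw [← h]; unfold output; rw [State.write_of_ne _ _ _ hi1.symm])
    (by simp) ?_ ?_
  · intro j s' hj hs hf hI
    refine (hstep ⟨j, hj⟩ s' hs hf).mono fun s'' _ h => ?_
    rw [h, hI, List.append_assoc, List.take_add_one]
    simp [List.flatMap_append, hj]
  · intro s' hf hI
    exact hQ s' hf (by rw [hI, List.take_of_length_le (by simp)])

end RAM

/-! ### Degeneracy. -/

namespace SimpleGraph

/-- The vertex of `S` that comes first in the ordering works: all its neighbours in `S` come later.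
-/
theorem HasDegeneracyOrdering.exists_degree_le {V : Type} [Fintype V] {G : SimpleGraph V}
    [DecidableRel G.Adj] {d : ℕ} (h : G.HasDegeneracyOrdering d) {S : Finset V}
    (hS : S.Nonempty) : ∃ v ∈ S, (S.filter fun x => G.Adj v x).card ≤ d := by
  obtain ⟨σ, hσ⟩ := h
  obtain ⟨v, hv, hmin⟩ := S.exists_min_image σ.symm hS
  refine ⟨v, hv, le_trans ?_ (hσ (σ.symm v))⟩
  rw [← Set.ncard_coe_finset, ← Set.ncard_image_of_injective _ σ.symm.injective]
  refine Set.ncard_le_ncard ?_ (Set.toFinite _)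
  rintro _ ⟨x, hx, rfl⟩
  simp only [Finset.coe_filter, Set.mem_ofPred_eq] at hx
  refine ⟨lt_of_le_of_ne (hmin x hx.1) fun h => ?_, by simpa using hx.2⟩
  exact G.ne_of_adj hx.2 (σ.symm.injective h)

theorem hasDegeneracyOrdering_degeneracy {V : Type} [Fintype V] (G : SimpleGraph V) :
    G.HasDegeneracyOrdering G.degeneracy :=
  Nat.sInf_mem G.exists_hasDegeneracyOrdering

theorem degeneracy_le_card {V : Type} [Fintype V] (G : SimpleGraph V) :
    G.degeneracy ≤ Fintype.card V :=
  Nat.sInf_le ⟨(Fintype.equivFin V).symm, fun _ => by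
    simpa using Set.ncard_le_card (α := Fin (Fintype.card V)) _⟩

end SimpleGraph

/-! ### Mistakes and costs. -/

namespace FuzzyGraph

theorem IsNonedge.symm {V : Type} {G : FuzzyGraph V} {u v : V} (h : G.IsNonedge u v) :
    G.IsNonedge v u :=
  ⟨h.1.symm, fun h' => h.2.1 h'.symm, fun h' => h.2.2 h'.symm⟩

variable {V : Type} [Fintype V] [DecidableEq V] (G : FuzzyGraph V)
  (C : Finpartition (Finset.univ : Finset V))

theorem mem_part_comm {u v : V} : u ∈ C.part v ↔ v ∈ C.part u := by
  rw [C.mem_part_iff_part_eq_part (Finset.mem_univ _) (Finset.mem_univ _),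
    C.mem_part_iff_part_eq_part (Finset.mem_univ _) (Finset.mem_univ _), eq_comm]

theorem isMistake_mk {u v : V} : G.IsMistake C s(u, v) ↔
    (G.real.Adj u v ∧ u ∉ C.part v) ∨ (G.IsNonedge u v ∧ u ∈ C.part v) := by
  constructor
  · rintro ⟨a, b, he, h⟩
    rcases Sym2.eq_iff.1 he with ⟨rfl, rfl⟩ | ⟨rfl, rfl⟩
    · exact h
    · rw [mem_part_comm C]
      exact h.imp (fun h => ⟨h.1.symm, h.2⟩) fun h => ⟨h.1.symm, h.2⟩
  · exact fun h => ⟨u, v, rfl, h⟩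

end FuzzyGraph

namespace CCInstance

open Classical in
/-- The cost of an ordered vertex pair in a clustering, given as an equivalence relation. -/
noncomputable def pairCost (I : CCInstance) (E : Fin I.n → Fin I.n → Prop) (u v : Fin I.n) : ℕ :=
  if E u v then if I.graph.real.Adj u v then 0 else I.weight s(u, v)
  else if I.graph.real.Adj u v then I.weight s(u, v) else 0

theorem weight_self (I : CCInstance) (u : Fin I.n) : I.weight s(u, u) = 0 :=
  (I.weight_eq_zero_iff u u).2 (Or.inl rfl)

theorem weight_pos_of_adj (I : CCInstance) {u v : Fin I.n} (h : I.graph.real.Adj u v) :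
    0 < I.weight s(u, v) := by
  refine Nat.pos_of_ne_zero fun h0 => ?_
  rcases (I.weight_eq_zero_iff u v).1 h0 with rfl | hf
  · exact I.graph.real.irrefl h
  · exact I.graph.disjoint _ _ ⟨h, hf⟩

theorem isNonedge_iff (I : CCInstance) {u v : Fin I.n} :
    I.graph.IsNonedge u v ↔ ¬ I.graph.real.Adj u v ∧ I.weight s(u, v) ≠ 0 := by
  rw [Ne, I.weight_eq_zero_iff, FuzzyGraph.IsNonedge]
  tauto

open Classical in
theorem pairCost_eq (I : CCInstance) (C : Finpartition (Finset.univ : Finset (Fin I.n)))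
    (u v : Fin I.n) : I.pairCost (fun u v => u ∈ C.part v) u v =
      if I.graph.IsMistake C s(u, v) then I.weight s(u, v) else 0 := by
  rw [FuzzyGraph.isMistake_mk, isNonedge_iff]
  unfold pairCost
  by_cases h1 : u ∈ C.part v <;> by_cases h2 : I.graph.real.Adj u v <;>
    by_cases h3 : I.weight s(u, v) = 0 <;> simp [h1, h2, h3]

/-- Each pair of distinct vertices comes from two ordered pairs, and diagonal pairs have weight `0`.
-/
theorem two_mul_cost (I : CCInstance) (C : Finpartition (Finset.univ : Finset (Fin I.n))) :
    2 * I.graph.cost I.weight C = ∑ u, ∑ v, I.pairCost (fun u v => u ∈ C.part v) u v := by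
  classical
  rw [FuzzyGraph.cost, Finset.mul_sum, Finset.sum_filter,
    ← Finset.sum_product' (s := Finset.univ) (t := Finset.univ),
    ← Finset.sum_fiberwise_of_maps_to (t := Finset.univ) (g := fun p : Fin I.n × Fin I.n =>
      s(p.1, p.2)) (fun _ _ => Finset.mem_univ _)]
  refine Finset.sum_congr rfl fun e _ => ?_
  induction e using Sym2.ind with
  | _ a b =>
    simp only [pairCost_eq]
    have h1 : ∀ p ∈ Finset.filter (fun p : Fin I.n × Fin I.n => s(p.1, p.2) = s(a, b))
        (Finset.univ ×ˢ Finset.univ),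
        (if I.graph.IsMistake C s(p.1, p.2) then I.weight s(p.1, p.2) else 0) =
          if I.graph.IsMistake C s(a, b) then I.weight s(a, b) else 0 := by
      intro p hp
      rw [(Finset.mem_filter.1 hp).2]
    rw [Finset.sum_congr rfl h1, Finset.sum_const, smul_eq_mul]
    by_cases hab : a = b
    · subst hab
      simp [I.weight_self]
    · have h2 : Finset.filter (fun p : Fin I.n × Fin I.n => s(p.1, p.2) = s(a, b))
          (Finset.univ ×ˢ Finset.univ) = {(a, b), (b, a)} := by
        ext ⟨x, y⟩
        simp
      rw [h2, Finset.card_pair (by simp [hab])]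
      split_ifs <;> simp

/-- Equivalence relations are easier than partitions to pull back to the representatives and to
extend from them. -/
theorem isYes_iff (I : CCInstance) : I.IsYes ↔
    ∃ E : Setoid (Fin I.n), ∑ u, ∑ v, I.pairCost (fun u v => E u v) u v ≤ 2 * I.k := by
  classical
  constructor
  · rintro ⟨C, hC⟩
    refine ⟨Setoid.ker C.part, ?_⟩
    have : ∀ u v, (Setoid.ker C.part) u v ↔ u ∈ C.part v := fun u v => by
      rw [C.mem_part_iff_part_eq_part (Finset.mem_univ _) (Finset.mem_univ _), Setoid.ker_def]
    simp only [this]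
    rw [← two_mul_cost]
    omega
  · rintro ⟨E, hE⟩
    refine ⟨Finpartition.ofSetoid E, ?_⟩
    have h := I.two_mul_cost (Finpartition.ofSetoid E)
    have : ∀ u v, u ∈ (Finpartition.ofSetoid E).part v ↔ E u v := fun u v => by
      rw [Finpartition.mem_part_ofSetoid_iff_rel]
      exact ⟨E.symm, E.symm⟩
    simp only [this] at h
    omega

/-! ### Dirty vertices with few common neighbours. -/

/-- A vertex is dirty if its component in the graph of the real edges contains a nonedge. -/
def Dirty (I : CCInstance) (v : Fin I.n) : Prop :=
  ∃ x y, I.graph.real.Reachable v x ∧ I.graph.real.Reachable v y ∧ I.graph.IsNonedge x y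

theorem Dirty.of_reachable {I : CCInstance} {u v : Fin I.n} (h : I.Dirty u)
    (huv : I.graph.real.Reachable u v) : I.Dirty v := by
  obtain ⟨x, y, hx, hy, hn⟩ := h
  exact ⟨x, y, huv.symm.trans hx, huv.symm.trans hy, hn⟩

open Classical in
/-- The number of common real neighbours. -/
noncomputable def common (I : CCInstance) (u v : Fin I.n) : ℕ :=
  (Finset.univ.filter fun x => I.graph.real.Adj u x ∧ I.graph.real.Adj v x).card

open Classical in
theorem card_mistakes_le (I : CCInstance) (C : Finpartition (Finset.univ : Finset (Fin I.n))) :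
    (Finset.univ.filter fun e => I.graph.IsMistake C e).card ≤ I.graph.cost I.weight C := by
  rw [FuzzyGraph.cost, Finset.card_eq_sum_ones]
  refine Finset.sum_le_sum fun e he => ?_
  have he := (Finset.mem_filter.1 he).2
  induction e using Sym2.ind with
  | _ a b =>
    rcases (FuzzyGraph.isMistake_mk _ _).1 he with h | h
    · exact I.weight_pos_of_adj h.1
    · exact Nat.pos_of_ne_zero (I.isNonedge_iff.1 h.1).2

/-- A common neighbour in the cluster of `u` is separated from `v`, and any other one is separated
from `u`. Distinct neighbours give distinct mistakes. -/
theorem common_le_cost (I : CCInstance) (C : Finpartition (Finset.univ : Finset (Fin I.n)))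
    {u v : Fin I.n} (h : u ∉ C.part v) : I.common u v ≤ I.graph.cost I.weight C := by
  classical
  refine le_trans ?_ (I.card_mistakes_le C)
  have hpart : ∀ x, x ∈ C.part u → x ∉ C.part v := by
    intro x hx hx'
    rw [C.mem_part_iff_part_eq_part (Finset.mem_univ _) (Finset.mem_univ _)] at hx hx' h
    exact h (hx.symm.trans hx')
  refine Finset.card_le_card_of_injOn (fun x => if x ∈ C.part u then s(v, x) else s(u, x)) ?_ ?_
  · intro x hx
    simp only [Finset.coe_filter, Finset.mem_univ, true_and, Set.mem_ofPred_eq] at hx ⊢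
    split_ifs with hxu
    · rw [FuzzyGraph.isMistake_mk, FuzzyGraph.mem_part_comm]
      exact Or.inl ⟨hx.2, hpart x hxu⟩
    · rw [FuzzyGraph.isMistake_mk, FuzzyGraph.mem_part_comm]
      exact Or.inl ⟨hx.1, hxu⟩
  · intro x hx y hy hxy
    simp only [Finset.coe_filter, Finset.mem_univ, true_and, Set.mem_ofPred_eq] at hx hy hxy
    have h1 := I.graph.real.ne_of_adj hx.1
    have h2 := I.graph.real.ne_of_adj hx.2
    have h3 := I.graph.real.ne_of_adj hy.1
    have h4 := I.graph.real.ne_of_adj hy.2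
    split_ifs at hxy <;> rcases Sym2.eq_iff.1 hxy with ⟨_, _⟩ | ⟨_, _⟩ <;> simp_all

/-- A vertex is touched by a clustering if it is in one of its mistakes. -/
def Touched (I : CCInstance) (C : Finpartition (Finset.univ : Finset (Fin I.n)))
    (v : Fin I.n) : Prop :=
  ∃ u, I.graph.IsMistake C s(v, u)

open Classical in
theorem card_touched_le (I : CCInstance) (C : Finpartition (Finset.univ : Finset (Fin I.n))) :
    (Finset.univ.filter (I.Touched C)).card ≤ 2 * I.graph.cost I.weight C := by
  have h : Finset.univ.filter (I.Touched C) ⊆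
      (Finset.univ.filter fun e => I.graph.IsMistake C e).biUnion fun e => e.toFinset := by
    intro v hv
    obtain ⟨u, hu⟩ := (Finset.mem_filter.1 hv).2
    exact Finset.mem_biUnion.2 ⟨s(v, u), by simpa using hu, by simp⟩
  refine (Finset.card_le_card h).trans ((Finset.card_biUnion_le_card_mul _ _ 2 ?_).trans ?_)
  · intro e _
    rw [Sym2.card_toFinset]
    split_ifs <;> omega
  · have := I.card_mistakes_le C
    omega

/-- If no vertex in the cluster of `v` is touched, then no real edge leaves the cluster. So it
contains the whole component of `v`, including a nonedge, which is then a mistake. -/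
theorem Dirty.exists_touched {I : CCInstance} {v : Fin I.n} (h : I.Dirty v)
    (C : Finpartition (Finset.univ : Finset (Fin I.n))) : ∃ t, v ∈ C.part t ∧ I.Touched C t := by
  by_contra! hC
  obtain ⟨x, y, hx, hy, hn⟩ := h
  have key : ∀ z, I.graph.real.Reachable v z → v ∈ C.part z := by
    intro z hz
    rw [SimpleGraph.reachable_iff_reflTransGen] at hz
    induction hz with
    | refl => exact C.mem_part (Finset.mem_univ _)
    | @tail a b _ hab ih =>
      by_contra hb
      refine hC a ih ⟨b, (FuzzyGraph.isMistake_mk _ _).2 (Or.inl ⟨hab, fun hab' => hb ?_⟩)⟩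
      rw [C.mem_part_iff_part_eq_part (Finset.mem_univ _) (Finset.mem_univ _)] at *
      exact ih.trans hab'
  refine hC x (key x hx) ⟨y, (FuzzyGraph.isMistake_mk _ _).2 (Or.inr ⟨hn, ?_⟩)⟩
  have h1 := key x hx
  have h2 := key y hy
  rw [C.mem_part_iff_part_eq_part (Finset.mem_univ _) (Finset.mem_univ _)] at *
  exact h1.symm.trans h2

-- Untouched vertices with few common neighbours need large fuzzy degree in a large cluster, and
-- `hq` allows this for few vertices only. In a small cluster there is little room anyway.
open Classical in
theorem card_le_of_untouched (I : CCInstance)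
    (C : Finpartition (Finset.univ : Finset (Fin I.n))) (t : Fin I.n) (U : Finset (Fin I.n))
    (q : ℕ) (hUP : U ⊆ C.part t) (hU : ∀ u ∈ U, ¬ I.Touched C u)
    (hcom : ∀ u ∈ U, ∀ v ∈ U, u ≠ v → I.common u v ≤ I.k)
    (hq : ∑ u ∈ C.part t, ((C.part t).filter fun x => I.graph.fuzzy.Adj u x).card ≤
      2 * q * (C.part t).card) :
    U.card ≤ 8 * q + 2 * I.k + 3 := by
  set P := C.part t with hP
  set f := fun u => (P.filter fun x => I.graph.fuzzy.Adj u x).card with hf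
  have hpair : ∀ u ∈ U, ∀ v ∈ U, u ≠ v → P.card ≤ 2 + I.k + f u + f v := by
    intro u hu v hv huv
    have hadj : ∀ u ∈ U, ∀ x ∈ P, x ≠ u → ¬ I.graph.fuzzy.Adj u x → I.graph.real.Adj u x := by
      intro u hu x hx hxu hxf
      by_contra hr
      refine hU u hu ⟨x, (FuzzyGraph.isMistake_mk _ _).2 (Or.inr ⟨⟨hxu.symm, hr, hxf⟩, ?_⟩)⟩
      have h1 := hUP hu
      rw [hP, C.mem_part_iff_part_eq_part (Finset.mem_univ _) (Finset.mem_univ _)] at h1 hx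
      rw [C.mem_part_iff_part_eq_part (Finset.mem_univ _) (Finset.mem_univ _)]
      exact h1.trans hx.symm
    -- A vertex of `P` other than `u` and `v` is a common real neighbour of both unless it is a
    -- fuzzy neighbour of one of them.
    have hsub : P ⊆ (({u, v} ∪ Finset.univ.filter fun x => I.graph.real.Adj u x ∧
        I.graph.real.Adj v x) ∪ P.filter fun x => I.graph.fuzzy.Adj u x) ∪
        P.filter fun x => I.graph.fuzzy.Adj v x := by
      intro x hx
      have h1 := hadj u hu x hx
      have h2 := hadj v hv x hx
      simp only [Finset.mem_union, Finset.mem_filter, Finset.mem_insert, Finset.mem_singleton,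
        Finset.mem_univ, true_and]
      tauto
    have h1 := Finset.card_le_card hsub
    have h2 := hcom u hu v hv huv
    have h3 := Finset.card_union_le ({u, v} : Finset (Fin I.n)) (Finset.univ.filter fun x =>
      I.graph.real.Adj u x ∧ I.graph.real.Adj v x)
    have h4 := h1.trans ((Finset.card_union_le _ _).trans
      (Nat.add_le_add_right ((Finset.card_union_le _ _).trans (Nat.add_le_add_right h3 _)) _))
    rw [Finset.card_pair huv] at h4
    refine h4.trans ?_
    have h5 : (Finset.univ.filter fun x => I.graph.real.Adj u x ∧ I.graph.real.Adj v x).card ≤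
        I.k := h2
    simp only [hf]
    omega
  rcases U.eq_empty_or_nonempty with rfl | hne
  · simp
  obtain ⟨u₀, hu₀, hmin⟩ := U.exists_min_image f hne
  -- Since `f u₀` is minimal, `hpair` gives `|P| - (2 + k) ≤ 2 * f v` for every other `v ∈ U`; sum
  -- over these `v`.
  have hsum : (U.card - 1) * (P.card - (2 + I.k)) ≤ 4 * q * P.card := by
    have h1 : ∑ v ∈ U.erase u₀, (P.card - (2 + I.k)) ≤ ∑ v ∈ U.erase u₀, 2 * f v := by
      refine Finset.sum_le_sum fun v hv => ?_
      have hv' := Finset.mem_of_mem_erase hv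
      have h2 := hpair u₀ hu₀ v hv' (Finset.ne_of_mem_erase hv).symm
      have h3 := hmin v hv'
      omega
    rw [Finset.sum_const, Finset.card_erase_of_mem hu₀, smul_eq_mul, ← Finset.mul_sum] at h1
    have h2 : ∑ v ∈ U.erase u₀, f v ≤ ∑ v ∈ P, f v :=
      Finset.sum_le_sum_of_subset ((Finset.erase_subset _ _).trans hUP)
    have h3 : ∑ v ∈ P, f v ≤ 2 * q * P.card := hq
    nlinarith
  have hcard := Finset.card_le_card hUP
  -- If `P` is this large, then subtracting `2 + k` leaves at least half of `|P|`, whence `|U| - 1 ≤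
  -- 8q`. Otherwise `|U| ≤ |P| ≤ 2k + 3`.
  by_cases hbig : 2 * (2 + I.k) ≤ P.card
  · have h1 : P.card ≤ 2 * (P.card - (2 + I.k)) := by omega
    have h2 : (U.card - 1) * P.card ≤ (8 * q) * P.card :=
      calc (U.card - 1) * P.card ≤ (U.card - 1) * (2 * (P.card - (2 + I.k))) :=
            Nat.mul_le_mul_left _ h1
        _ = 2 * ((U.card - 1) * (P.card - (2 + I.k))) := by ring
        _ ≤ 2 * (4 * q * P.card) := Nat.mul_le_mul_left _ hsum
        _ = (8 * q) * P.card := by ring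
    have h3 := Nat.le_of_mul_le_mul_right h2 (by omega)
    omega
  · omega

open Classical in
/-- Few dirty vertices of a yes-instance have pairwise few common neighbours. -/
theorem card_le_of_isYes (I : CCInstance) (hI : I.IsYes) (K : Finset (Fin I.n)) (q : ℕ)
    (hK : ∀ v ∈ K, I.Dirty v) (hcom : ∀ u ∈ K, ∀ v ∈ K, u ≠ v → I.common u v ≤ I.k)
    (hq : ∀ P : Finset (Fin I.n), ∑ u ∈ P, (P.filter fun x => I.graph.fuzzy.Adj u x).card ≤
      2 * q * P.card) :
    K.card ≤ 2 * I.k * (8 * q + 2 * I.k + 4) := by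
  obtain ⟨C, hC⟩ := hI
  set T := Finset.univ.filter (I.Touched C) with hT
  have hTcard : T.card ≤ 2 * I.k := (I.card_touched_le C).trans (by omega)
  -- At most `2k` vertices of `K` are touched; the others lie in the clusters of touched vertices.
  have hsub : K ⊆ T ∪ T.biUnion fun t => (K \ T) ∩ C.part t := by
    intro v hv
    by_cases hvT : v ∈ T
    · exact Finset.mem_union_left _ hvT
    · obtain ⟨t, ht, ht'⟩ := (hK v hv).exists_touched C
      exact Finset.mem_union_right _ (Finset.mem_biUnion.2 ⟨t, by simpa [hT] using ht',
        Finset.mem_inter.2 ⟨Finset.mem_sdiff.2 ⟨hv, hvT⟩, ht⟩⟩)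
  have h1 := (Finset.card_le_card hsub).trans (Finset.card_union_le _ _)
  have h2 := Finset.card_biUnion_le_card_mul T (fun t => (K \ T) ∩ C.part t)
    (8 * q + 2 * I.k + 3) (fun t _ => I.card_le_of_untouched C t _ q Finset.inter_subset_right
      (fun u hu => by
        have := (Finset.mem_sdiff.1 (Finset.mem_inter.1 hu).1).2
        simpa [hT] using this)
      (fun u hu v hv => hcom u (Finset.mem_sdiff.1 (Finset.mem_inter.1 hu).1).1 v
        (Finset.mem_sdiff.1 (Finset.mem_inter.1 hv).1).1) (hq _))
  have h3 : T.card * (8 * q + 2 * I.k + 3) ≤ 2 * I.k * (8 * q + 2 * I.k + 3) :=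
    Nat.mul_le_mul_right _ hTcard
  calc K.card ≤ 2 * I.k + 2 * I.k * (8 * q + 2 * I.k + 3) := by omega
    _ = 2 * I.k * (8 * q + 2 * I.k + 4) := by ring

/-! ### Merging classes of vertices. -/

/-- A choice of representatives `L a` of classes of vertices that have to be in the same cluster,
without the clean vertices. -/
structure Merging (I : CCInstance) (m : ℕ) where
  rep : Fin I.n → Fin I.n
  L : Fin m → Fin I.n
  rep_rep : ∀ v, rep (rep v) = rep v
  rep_eq_or : ∀ v, rep v = v ∨ I.k < I.common (rep v) v
  common_le : ∀ u v, u ≠ v → rep u = u → rep v = v → I.common u v ≤ I.k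
  injective : Function.Injective L
  exists_iff : ∀ v, (∃ a, L a = v) ↔ rep v = v ∧ I.Dirty v

namespace Merging

variable {I : CCInstance} {m : ℕ} (M : Merging I m)

theorem reachable_of_common_pos {u v : Fin I.n} (h : 0 < I.common u v) :
    I.graph.real.Reachable u v := by
  unfold common at h
  obtain ⟨x, hx⟩ := Finset.card_pos.1 h
  simp only [Finset.mem_filter, Finset.mem_univ, true_and] at hx
  exact hx.1.reachable.trans hx.2.reachable.symm

theorem reachable_rep (v : Fin I.n) : I.graph.real.Reachable (M.rep v) v := by
  rcases M.rep_eq_or v with h | h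
  · rw [h]
  · exact reachable_of_common_pos (by omega)

theorem rep_L (a : Fin m) : M.rep (M.L a) = M.L a :=
  ((M.exists_iff _).1 ⟨a, rfl⟩).1

/-- A vertex that differs from its representative shares a real neighbour with it. So a class stays
within one component, and its members are all dirty or all clean. -/
theorem dirty_iff (v : Fin I.n) : I.Dirty v ↔ ∃ a, M.rep v = M.L a := by
  constructor
  · intro h
    obtain ⟨a, ha⟩ := (M.exists_iff (M.rep v)).2
      ⟨M.rep_rep v, h.of_reachable (M.reachable_rep v).symm⟩
    exact ⟨a, ha.symm⟩
  · rintro ⟨a, ha⟩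
    have := ((M.exists_iff (M.rep v)).1 ⟨a, ha.symm⟩).2
    exact this.of_reachable (M.reachable_rep v)

open Classical in
/-- The total weight of the real edges between two classes. -/
noncomputable def pos (a b : Fin m) : ℕ :=
  ∑ u, ∑ v, if M.rep u = M.L a ∧ M.rep v = M.L b ∧ I.graph.real.Adj u v then
    I.weight s(u, v) else 0

open Classical in
/-- The total weight of the nonedges between two classes. -/
noncomputable def neg (a b : Fin m) : ℕ :=
  ∑ u, ∑ v, if M.rep u = M.L a ∧ M.rep v = M.L b ∧ ¬ I.graph.real.Adj u v then
    I.weight s(u, v) else 0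

theorem pos_comm (a b : Fin m) : M.pos a b = M.pos b a := by
  unfold pos
  rw [Finset.sum_comm]
  refine Finset.sum_congr rfl fun u _ => Finset.sum_congr rfl fun v _ => ?_
  rw [Sym2.eq_swap, I.graph.real.adj_comm]
  congr 1
  exact propext (by tauto)

theorem neg_comm (a b : Fin m) : M.neg a b = M.neg b a := by
  unfold neg
  rw [Finset.sum_comm]
  refine Finset.sum_congr rfl fun u _ => Finset.sum_congr rfl fun v _ => ?_
  rw [Sym2.eq_swap, I.graph.real.adj_comm]
  congr 1
  exact propext (by tauto)

/-- Twice the cost that is paid in every clustering into unions of classes. -/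
noncomputable def total : ℕ :=
  ∑ a, ∑ b, if a = b then M.neg a b else min (M.pos a b) (M.neg a b)

/-- The instance in which each class is merged into one vertex. -/
noncomputable def merged : CCInstance where
  n := m
  graph :=
    { real :=
        { Adj := fun a b => a ≠ b ∧ M.neg a b < M.pos a b
          symm := ⟨fun a b h => by
            rw [M.neg_comm, M.pos_comm]
            exact ⟨h.1.symm, h.2⟩⟩
          loopless := ⟨fun a h => h.1 rfl⟩ }
      fuzzy :=
        { Adj := fun a b => a ≠ b ∧ M.pos a b = M.neg a b
          symm := ⟨fun a b h => by
            rw [M.neg_comm, M.pos_comm]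
            exact ⟨h.1.symm, h.2⟩⟩
          loopless := ⟨fun a h => h.1 rfl⟩ }
      disjoint := fun a b h => by
        have h1 := h.1.2
        have h2 := h.2.2
        omega }
  -- The two truncated differences add up to the absolute difference. The cap is positive, so no
  -- weight becomes `0` by it, and it exceeds `2k`, the largest possible doubled budget.
  weight := Sym2.lift ⟨fun a b => if a = b then 0 else
      min (M.pos a b - M.neg a b + (M.neg a b - M.pos a b)) (I.k + I.k + 1), fun a b => by
    dsimp only
    rw [M.neg_comm a b, M.pos_comm a b]
    simp only [eq_comm]⟩
  weight_eq_zero_iff := fun a b => by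
    by_cases hab : a = b
    · simp [hab]
    · simp only [Sym2.lift_mk, hab, if_false, false_or, ne_eq, not_false_eq_true, true_and]
      omega
  -- The subtraction is truncated; the merged instance is used only when `M.total / 2 ≤ I.k`.
  k := I.k - M.total / 2

theorem merged_adj (a b : Fin m) :
    M.merged.graph.real.Adj a b ↔ a ≠ b ∧ M.neg a b < M.pos a b := Iff.rfl

theorem merged_weight (a b : Fin m) : M.merged.weight s(a, b) = if a = b then 0 else
    min (M.pos a b - M.neg a b + (M.neg a b - M.pos a b)) (I.k + I.k + 1) := rfl

open Classical in
theorem sum_dirty (g : Fin I.n → ℕ) :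
    ∑ u, (if I.Dirty u then g u else 0) = ∑ a, ∑ u, if M.rep u = M.L a then g u else 0 := by
  rw [Finset.sum_comm]
  refine Finset.sum_congr rfl fun u _ => ?_
  split_ifs with h
  · obtain ⟨a, ha⟩ := (M.dirty_iff u).1 h
    rw [Finset.sum_eq_single a]
    · simp [ha]
    · intro b _ hb
      rw [if_neg fun h' => hb (M.injective (h'.symm.trans ha))]
    · simp
  · refine (Finset.sum_eq_zero fun a _ => ?_).symm
    rw [if_neg fun h' => h ((M.dirty_iff u).2 ⟨a, h'⟩)]

-- Fuzzy pairs and diagonal pairs have weight `0`, so `neg` is exactly what two classes pay for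
-- being together, also when `a = b`.
open Classical in
theorem sum_pairCost (E : Fin I.n → Fin I.n → Prop)
    (hE : ∀ u v, I.Dirty u → I.Dirty v → (E u v ↔ E (M.rep u) (M.rep v))) :
    ∑ u, ∑ v, (if I.Dirty u ∧ I.Dirty v then I.pairCost E u v else 0) =
      ∑ a, ∑ b, if E (M.L a) (M.L b) then M.neg a b else M.pos a b := by
  have h1 : ∀ u, ∑ v, (if I.Dirty u ∧ I.Dirty v then I.pairCost E u v else 0) =
      if I.Dirty u then ∑ b, ∑ v, (if M.rep v = M.L b then I.pairCost E u v else 0) else 0 := by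
    intro u
    split_ifs with hu
    · rw [← sum_dirty]
      simp [hu]
    · simp [hu]
  rw [Finset.sum_congr rfl fun u _ => h1 u, sum_dirty]
  refine Finset.sum_congr rfl fun a _ => ?_
  have h2 : ∀ u, (if M.rep u = M.L a then
      ∑ b, ∑ v, (if M.rep v = M.L b then I.pairCost E u v else 0) else 0) =
      ∑ b, if M.rep u = M.L a then ∑ v, (if M.rep v = M.L b then I.pairCost E u v else 0)
        else 0 := by
    intro u
    split_ifs <;> simp
  rw [Finset.sum_congr rfl fun u _ => h2 u, Finset.sum_comm]
  refine Finset.sum_congr rfl fun b _ => ?_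
  have h3 : ∀ u v, M.rep u = M.L a → M.rep v = M.L b → (E u v ↔ E (M.L a) (M.L b)) := by
    intro u v hu hv
    rw [hE u v ((M.dirty_iff u).2 ⟨a, hu⟩) ((M.dirty_iff v).2 ⟨b, hv⟩), hu, hv]
  unfold neg pos pairCost
  by_cases hab : E (M.L a) (M.L b)
  · rw [if_pos hab]
    refine Finset.sum_congr rfl fun u _ => ?_
    split_ifs with hu
    · refine Finset.sum_congr rfl fun v _ => ?_
      by_cases hv : M.rep v = M.L b
      · by_cases hr : I.graph.real.Adj u v <;> simp [hu, hv, (h3 u v hu hv).2 hab, hr]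
      · simp [hv]
    · simp [hu]
  · rw [if_neg hab]
    refine Finset.sum_congr rfl fun u _ => ?_
    split_ifs with hu
    · refine Finset.sum_congr rfl fun v _ => ?_
      by_cases hv : M.rep v = M.L b
      · by_cases hr : I.graph.real.Adj u v <;>
          simp [hu, hv, mt (h3 u v hu hv).1 hab, hr]
      · simp [hv]
    · simp [hu]

open Classical in
/-- The cost of a vertex pair of the merged instance, before the weights are capped. -/
noncomputable def excess (E : Fin m → Fin m → Prop) (a b : Fin m) : ℕ :=
  if a = b then 0 else if E a b then M.neg a b - M.pos a b else M.pos a b - M.neg a b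

theorem merged_pairCost {E : Fin m → Fin m → Prop} (a b : Fin m) :
    M.merged.pairCost E a b = min (M.excess E a b) (I.k + I.k + 1) := by
  unfold pairCost excess
  simp only [merged_weight, merged_adj]
  by_cases hab : a = b
  · simp [hab]
  · by_cases h : M.neg a b < M.pos a b <;> by_cases h' : E a b <;> simp [hab, h, h'] <;> omega

theorem merged_isYes_iff : M.merged.IsYes ↔ ∃ E : Setoid (Fin m),
    ∑ a, ∑ b, min (M.excess (fun a b => E a b) a b) (I.k + I.k + 1) ≤
      2 * (I.k - M.total / 2) := by
  have h : ∀ E : Setoid (Fin m), ∑ a : Fin m, ∑ b : Fin m,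
      M.merged.pairCost (fun a b => E a b) a b =
      ∑ a, ∑ b, min (M.excess (fun a b => E a b) a b) (I.k + I.k + 1) := fun E =>
    Finset.sum_congr rfl fun a _ => Finset.sum_congr rfl fun b _ => M.merged_pairCost a b
  rw [isYes_iff]
  exact ⟨fun ⟨E, hE⟩ => ⟨E, (h E).symm.le.trans hE⟩, fun ⟨E, hE⟩ => ⟨E, (h E).le.trans hE⟩⟩

-- For two classes this is `x = min x y + (x - y)` with truncated subtraction. For `a = b`
-- reflexivity selects `neg a a`, which `total` contains in full.
open Classical in
theorem sum_eq_total_add {E : Fin m → Fin m → Prop} (hE : ∀ a, E a a) :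
    (∑ a, ∑ b, if E a b then M.neg a b else M.pos a b) =
      M.total + ∑ a, ∑ b, M.excess E a b := by
  unfold total
  rw [← Finset.sum_add_distrib]
  refine Finset.sum_congr rfl fun a _ => ?_
  rw [← Finset.sum_add_distrib]
  refine Finset.sum_congr rfl fun b _ => ?_
  unfold excess
  by_cases hab : a = b
  · subst hab
    simp [hE]
  · by_cases h : E a b <;> simp only [hab, h, if_true, if_false] <;> omega

/-- A clustering of cost at most `k` does not split a class. Restricting it to the dirty vertices
and capping the weights only lowers the cost. -/
theorem merged_isYes_of_isYes (h : I.IsYes) : M.total / 2 ≤ I.k ∧ M.merged.IsYes := by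
  classical
  obtain ⟨C, hC⟩ := h
  set E : Setoid (Fin I.n) := Setoid.ker C.part with hE
  have hE' : ∀ u v, E u v ↔ u ∈ C.part v := fun u v => by
    rw [C.mem_part_iff_part_eq_part (Finset.mem_univ _) (Finset.mem_univ _), hE, Setoid.ker_def]
  have hrep : ∀ v, E (M.rep v) v := by
    intro v
    rcases M.rep_eq_or v with h | h
    · rw [h]
    · rw [hE']
      by_contra h'
      have := I.common_le_cost C h'
      omega
  have h1 := M.sum_pairCost (fun u v => E u v) fun u v _ _ =>
    ⟨fun h => E.trans (hrep u) (E.trans h (E.symm (hrep v))),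
      fun h => E.trans (E.symm (hrep u)) (E.trans h (hrep v))⟩
  rw [M.sum_eq_total_add (E := fun a b => E (M.L a) (M.L b)) fun a => E.refl _] at h1
  have h2 := I.two_mul_cost C
  simp only [← hE'] at h2
  have h3 : ∑ u, ∑ v, (if I.Dirty u ∧ I.Dirty v then I.pairCost (fun u v => E u v) u v else 0) ≤
      ∑ u, ∑ v, I.pairCost (fun u v => E u v) u v := by
    refine Finset.sum_le_sum fun u _ => Finset.sum_le_sum fun v _ => ?_
    split_ifs <;> omega
  refine ⟨by omega, M.merged_isYes_iff.2 ⟨Setoid.comap M.L E, ?_⟩⟩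
  have h4 : ∑ a, ∑ b, min (M.excess (fun a b => Setoid.comap M.L E a b) a b) (I.k + I.k + 1) ≤
      ∑ a, ∑ b, M.excess (fun a b => E (M.L a) (M.L b)) a b :=
    Finset.sum_le_sum fun a _ => Finset.sum_le_sum fun b _ => min_le_left _ _
  omega

/-- Clusters of merged vertices are expanded to the unions of their classes, and each clean
component becomes a cluster of its own. -/
theorem isYes_of_merged_isYes (hk : M.total / 2 ≤ I.k) (h : M.merged.IsYes) : I.IsYes := by
  classical
  obtain ⟨E', hE'⟩ := M.merged_isYes_iff.1 h
  -- A capped term would contribute `2k + 1` to a sum that is at most `2k`.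
  have hcap : ∀ a b, min (M.excess (fun a b => E' a b) a b) (I.k + I.k + 1) =
      M.excess (fun a b => E' a b) a b := by
    intro a b
    refine min_eq_left ?_
    by_contra hab
    have h1 := (Finset.single_le_sum (f := fun b =>
      min (M.excess (fun a b => E' a b) a b) (I.k + I.k + 1)) (fun _ _ => Nat.zero_le _)
      (Finset.mem_univ b)).trans (Finset.single_le_sum (f := fun a => ∑ b,
      min (M.excess (fun a b => E' a b) a b) (I.k + I.k + 1)) (fun _ _ => Nat.zero_le _)
      (Finset.mem_univ a))
    omega
  simp only [hcap] at hE'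
  let E : Setoid (Fin I.n) :=
    { r := fun u v => (∃ a b, M.rep u = M.L a ∧ M.rep v = M.L b ∧ E' a b) ∨
        (¬ I.Dirty u ∧ I.graph.real.Reachable u v)
      iseqv :=
        { refl := fun u => by
            by_cases hu : I.Dirty u
            · obtain ⟨a, ha⟩ := (M.dirty_iff u).1 hu
              exact Or.inl ⟨a, a, ha, ha, E'.refl a⟩
            · exact Or.inr ⟨hu, SimpleGraph.Reachable.refl u⟩
          symm := by
            rintro u v (⟨a, b, ha, hb, hab⟩ | ⟨hu, huv⟩)
            · exact Or.inl ⟨b, a, hb, ha, E'.symm hab⟩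
            · exact Or.inr ⟨fun hv => hu (hv.of_reachable huv.symm), huv.symm⟩
          trans := by
            rintro u v w (⟨a, b, ha, hb, hab⟩ | ⟨hu, huv⟩) (⟨c, d, hc, hd, hcd⟩ | ⟨hv, hvw⟩)
            · obtain rfl := M.injective (hb.symm.trans hc)
              exact Or.inl ⟨a, d, ha, hd, E'.trans hab hcd⟩
            · exact absurd ((M.dirty_iff v).2 ⟨b, hb⟩) hv
            · exact absurd (((M.dirty_iff v).2 ⟨c, hc⟩).of_reachable huv.symm) hu
            · exact Or.inr ⟨hu, huv.trans hvw⟩ } }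
  have hEdef : ∀ u v, E u v ↔ (∃ a b, M.rep u = M.L a ∧ M.rep v = M.L b ∧ E' a b) ∨
        (¬ I.Dirty u ∧ I.graph.real.Reachable u v) := fun _ _ => Iff.rfl
  have hEL : ∀ a b, E (M.L a) (M.L b) ↔ E' a b := by
    intro a b
    rw [hEdef]
    constructor
    · rintro (⟨c, d, hc, hd, hcd⟩ | ⟨h, _⟩)
      · rw [M.rep_L] at hc hd
        rwa [M.injective hc, M.injective hd]
      · exact absurd ((M.dirty_iff _).2 ⟨a, M.rep_L a⟩) h
    · exact fun h => Or.inl ⟨a, b, M.rep_L a, M.rep_L b, h⟩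
  have h1 := M.sum_pairCost (fun u v => E u v) fun u v hu hv => by
    obtain ⟨a, ha⟩ := (M.dirty_iff u).1 hu
    obtain ⟨b, hb⟩ := (M.dirty_iff v).1 hv
    rw [ha, hb, hEL, hEdef]
    constructor
    · rintro (⟨c, d, hc, hd, hcd⟩ | ⟨h, _⟩)
      · rwa [M.injective (ha.symm.trans hc), M.injective (hb.symm.trans hd)]
      · exact absurd hu h
    · exact fun h => Or.inl ⟨a, b, ha, hb, h⟩
  simp only [hEL] at h1
  rw [M.sum_eq_total_add (E := fun a b => E' a b) fun a => E'.refl a] at h1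
  -- A pair with a clean vertex costs nothing: a clean component contains no nonedge, and no real
  -- edge leaves it.
  have h2 : ∀ u v, (if I.Dirty u ∧ I.Dirty v then I.pairCost (fun u v => E u v) u v else 0) =
      I.pairCost (fun u v => E u v) u v := by
    intro u v
    split_ifs with hd
    · rfl
    · symm
      unfold pairCost
      by_cases huv : E u v
      · rw [if_pos huv]
        split_ifs with hr
        · rfl
        · by_contra hw
          rcases (hEdef u v).1 huv with ⟨a, b, ha, hb, _⟩ | ⟨hu, huv'⟩
          · exact hd ⟨(M.dirty_iff u).2 ⟨a, ha⟩, (M.dirty_iff v).2 ⟨b, hb⟩⟩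
          · exact hu ⟨u, v, SimpleGraph.Reachable.refl u, huv', I.isNonedge_iff.2 ⟨hr, hw⟩⟩
      · rw [if_neg huv, if_neg]
        intro hr
        have hu : I.Dirty u := by
          by_contra hu
          exact huv (Or.inr ⟨hu, hr.reachable⟩)
        exact hd ⟨hu, hu.of_reachable hr.reachable⟩
  simp only [h2] at h1
  rw [isYes_iff]
  -- Rounding in `M.total / 2` only yields the bound `2k + 1` for this sum. The sum is even, so it
  -- is at most `2k`.
  have heven : ∑ u, ∑ v, I.pairCost (fun u v => E u v) u v =
      2 * I.graph.cost I.weight (Finpartition.ofSetoid E) := by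
    rw [two_mul_cost]
    have : ∀ u v, u ∈ (Finpartition.ofSetoid E).part v ↔ E u v := fun u v => by
      rw [Finpartition.mem_part_ofSetoid_iff_rel]
      exact ⟨E.symm, E.symm⟩
    simp only [this]
  exact ⟨E, by omega⟩

theorem card_le_of_isYes (M : Merging I m) (h : I.IsYes) (q : ℕ)
    (hq : ∀ P : Finset (Fin I.n), ∑ u ∈ P, {x ∈ P | I.weight s(u, x) = 0 ∧ u ≠ x}.card ≤
      2 * q * P.card) :
    m ≤ 2 * I.k * (8 * q + 2 * I.k + 4) := by
  classical
  have := I.card_le_of_isYes h (Finset.univ.image M.L) q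
    (fun v hv => by
      obtain ⟨a, _, ha⟩ := Finset.mem_image.1 hv
      exact ((M.exists_iff v).1 ⟨a, ha⟩).2)
    (fun u hu v hv huv => by
      obtain ⟨a, _, ha⟩ := Finset.mem_image.1 hu
      obtain ⟨b, _, hb⟩ := Finset.mem_image.1 hv
      exact M.common_le u v huv ((M.exists_iff u).1 ⟨a, ha⟩).1 ((M.exists_iff v).1 ⟨b, hb⟩).1)
    (fun P => by
      refine le_trans (Finset.sum_le_sum fun u _ => Finset.card_le_card fun x hx => ?_) (hq P)
      obtain ⟨hx, hux⟩ := Finset.mem_filter.1 hx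
      exact Finset.mem_filter.2 ⟨hx, (I.weight_eq_zero_iff u x).2 (Or.inr hux),
        I.graph.fuzzy.ne_of_adj hux⟩)
  rwa [Finset.card_image_of_injective _ M.injective, Finset.card_univ, Fintype.card_fin] at this

end Merging

/-! ### The fixed no-instance and the size of encodings. -/

/-- The path on three vertices with budget `0`. -/
abbrev no : CCInstance where
  n := 3
  graph :=
    { real := SimpleGraph.pathGraph 3
      fuzzy := ⊥
      disjoint := fun _ _ h => h.2 }
  weight := Sym2.lift ⟨fun u v => if u = v then 0 else 1, fun u v => by simp only [eq_comm]⟩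
  weight_eq_zero_iff := fun u v => by simp
  k := 0

/-- The ends of the path have a common neighbour, so budget `0` forces them into one cluster; but
they form a nonedge. -/
theorem not_isYes_no : ¬ no.IsYes := by
  rintro ⟨C, hC⟩
  classical
  have h1 := (no.common_le_cost C (u := (0 : Fin 3)) (v := (2 : Fin 3)))
  have h2 : 0 < no.common (0 : Fin 3) (2 : Fin 3) := by
    refine Finset.card_pos.2 ⟨(1 : Fin 3), ?_⟩
    simp [no, SimpleGraph.pathGraph_adj]
  have hk : no.k = 0 := rfl
  have h02 : (0 : Fin 3) ∈ C.part (2 : Fin 3) := by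
    by_contra h
    have := h1 h
    omega
  have h3 := no.card_mistakes_le C
  have h4 : no.graph.IsMistake C s((0 : Fin 3), (2 : Fin 3)) := by
    rw [FuzzyGraph.isMistake_mk]
    refine Or.inr ⟨⟨by decide, ?_, fun h => h⟩, h02⟩
    simp [no, SimpleGraph.pathGraph_adj]
  have h5 := Finset.card_pos.2 ⟨_, Finset.mem_filter.2 ⟨Finset.mem_univ _, h4⟩⟩
  exact absurd (h5.trans_le (h3.trans (hC.trans hk.le))) (lt_irrefl _)

theorem code_no : no.code =
    [3, 0, 0, 1, 1, 1, 0, 1, 1, 1, 0, 0, 1, 0, 1, 0, 1, 0, 1, 0] := by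
  have h : List.finRange no.n = [(0 : Fin 3), (1 : Fin 3), (2 : Fin 3)] := rfl
  unfold code
  rw [h]
  simp [no, SimpleGraph.pathGraph_adj]

theorem length_code (I : CCInstance) : I.code.length = 2 + 2 * I.n ^ 2 := by
  simp [code, List.length_flatMap]
  ring

/-- A number `x ≤ c` has at most `c` binary digits, a crude bound that suffices. The fuzzy
degeneracy is estimated by the number of vertices. -/
theorem bitSize_code_add_param_le (I : CCInstance) (c : ℕ) (hn : I.n ≤ c) (hk : I.k ≤ c)
    (hc : 1 ≤ c) (hw : ∀ u v, I.weight s(u, v) ≤ c) :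
    RAM.bitSize I.code + I.param ≤ (2 + 2 * c ^ 2) * (c + 1) + 2 * c := by
  have h1 : ∀ x ∈ I.code, x ≤ c := by
    intro x hx
    simp only [code, List.mem_cons, List.mem_append, List.mem_flatMap, List.mem_map] at hx
    rcases hx with rfl | rfl | ⟨i, _, j, _, rfl⟩ | ⟨i, _, j, _, rfl⟩
    · exact hn
    · exact hk
    · exact hw i j
    · split_ifs <;> omega
  have h2 : RAM.bitSize I.code ≤ I.code.length * (c + 1) := by
    unfold RAM.bitSize
    refine (List.sum_le_card_nsmul _ (c + 1) ?_).trans (by simp)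
    intro y hy
    obtain ⟨x, hx, rfl⟩ := List.mem_map.1 hy
    have : x.size ≤ x := Nat.size_le.2 Nat.lt_two_pow_self
    have := h1 x hx
    omega
  have h3 : I.param ≤ 2 * c := by
    have := I.graph.fuzzy.degeneracy_le_card
    rw [Fintype.card_fin] at this
    unfold param d
    omega
  rw [length_code] at h2
  have h4 : (2 + 2 * I.n ^ 2) * (c + 1) ≤ (2 + 2 * c ^ 2) * (c + 1) := by gcongr
  omega

/-! ### Reading the input matrices. -/

open RAM

theorem pairIndex_inj {n : ℕ} {u v u' v' : Fin n} :
    u.val * n + v.val = u'.val * n + v'.val ↔ u = u' ∧ v = v' := by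
  constructor
  · intro h
    have hn : 0 < n := u.pos
    have h1 := congrArg (· / n) h
    have h2 := congrArg (· % n) h
    simp only [mul_comm _ n, Nat.mul_add_div hn, Nat.div_eq_of_lt v.2, Nat.div_eq_of_lt v'.2,
      Nat.mul_add_mod, Nat.mod_eq_of_lt v.2, Nat.mod_eq_of_lt v'.2, add_zero] at h1 h2
    exact ⟨Fin.ext h1, Fin.ext h2⟩
  · rintro ⟨rfl, rfl⟩
    rfl

/-- The input is stored in bank `0`. -/
structure HasInput (I : CCInstance) (s : State) : Prop where
  n_eq : s 0 1 = I.n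
  k_eq : s 0 2 = I.k
  weight_eq : ∀ u v : Fin I.n, s 0 (3 + (u * I.n + v)) = I.weight s(u, v)
  adj_iff : ∀ u v : Fin I.n, s 0 (3 + (I.n * I.n + (u * I.n + v))) ≠ 0 ↔ I.graph.real.Adj u v

/-- In addition, bank `2` contains the multiples of the number of vertices. -/
structure HasRows (I : CCInstance) (s : State) : Prop extends HasInput I s where
  row_eq : ∀ i ≤ I.n, s 2 i = i * I.n

theorem HasInput.congr {I : CCInstance} {s s' : State} (h : HasInput I s) (h0 : s' 0 = s 0) :
    HasInput I s' := by
  obtain ⟨h1, h2, h3, h4⟩ := h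
  constructor <;> simpa only [h0]

theorem HasRows.congr {I : CCInstance} {s s' : State} (h : HasRows I s) (h0 : s' 0 = s 0)
    (h2 : s' 2 = s 2) : HasRows I s' :=
  { h.toHasInput.congr h0 with row_eq := by simpa only [h2] using h.row_eq }

/-- Memory map: bank `0` input, `1` output, `2` row offsets, `3` reachability, `4` dirty flags, `5`
representatives, `6` and `7` list of dirty representatives and its length, `8` deleted vertices, `9`
the number `q`, `10` and `11` `pos` and `neg`, `12` `total`, `13` size bound, from `14` on auxiliary
registers and loop counters. -/
abbrev nExpr : Expr := .cell 0 (.lit 1)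

abbrev kExpr : Expr := .cell 0 (.lit 2)

def weightExpr (i j : Expr) : Expr := .cell 0 (.add (.lit 3) (.add (.cell 2 i) j))

def adjExpr (i j : Expr) : Expr :=
  .cell 0 (.add (.lit 3) (.add (.cell 2 nExpr) (.add (.cell 2 i) j)))

theorem HasRows.eval_weightExpr {I : CCInstance} {s : State} (h : HasRows I s) {i j : Expr}
    {u v : Fin I.n} (hi : i.eval s = u) (hj : j.eval s = v) :
    (weightExpr i j).eval s = I.weight s(u, v) := by
  simp only [weightExpr, Expr.eval, hi, hj, h.row_eq u u.2.le, h.weight_eq]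

theorem HasRows.eval_adjExpr {I : CCInstance} {s : State} (h : HasRows I s) {i j : Expr}
    {u v : Fin I.n} (hi : i.eval s = u) (hj : j.eval s = v) :
    (adjExpr i j).eval s ≠ 0 ↔ I.graph.real.Adj u v := by
  rw [← h.adj_iff]
  simp only [adjExpr, Expr.eval, hi, hj, h.n_eq, h.row_eq u u.2.le, h.row_eq I.n le_rfl]

/-- The machine cannot multiply, so the row offsets are tabulated by repeated addition. -/
def rowsProg : Prog :=
  .forLoop 20 nExpr (.assign 2 (.add (.reg 20) (.lit 1)) (.add (.cell 2 (.reg 20)) nExpr))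

theorem wp_rowsProg {I : CCInstance} {N : ℕ} {s : State} (hN : I.n ≤ N) (h : HasInput I s)
    (hs : s 2 0 = 0) : WP N rowsProg (HasRows I) s := by
  refine WP.forLoop I.n (fun j s' => ∀ i ≤ j, s' 2 i = i * I.n) hN (by decide)
    (fun s' hf => (h.congr (hf 0 (by decide))).n_eq)
    (fun j s' x hI => by rwa [State.write_of_ne _ _ _ (by decide)]) ?_ ?_ ?_
  · intro i hi
    obtain rfl : i = 0 := by omega
    simpa using hs
  · intro j s' hj hj' hf hI
    have h' := h.congr (hf 0 (by decide))
    refine WP.assign fun i hi => ?_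
    simp only [Expr.eval, hj', h'.n_eq, State.write_same]
    split_ifs with hij
    · rw [hij, hI j le_rfl]
      ring
    · exact hI i (by omega)
  · exact fun s' hf hI => { h.congr (hf 0 (by decide)) with row_eq := hI }

/-! ### Reachability by Warshall's algorithm. -/

/-- The relation stored as a matrix in bank `3`. -/
def Rel (n : ℕ) (s : State) (u v : Fin n) : Prop := s 3 (u * n + v) ≠ 0

theorem Rel.congr_state {n : ℕ} {s s' : State} (h : s' 3 = s 3) : Rel n s' = Rel n s := by
  unfold Rel
  rw [h]

theorem Rel.write {n : ℕ} (s : State) (u v : Fin n) (x : ℕ) (u' v' : Fin n) :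
    Rel n (s.write 3 (u * n + v) x) u' v' ↔
      if u' = u ∧ v' = v then x ≠ 0 else Rel n s u' v' := by
  unfold Rel
  rw [State.write_same]
  simp only [pairIndex_inj]
  split_ifs <;> rfl

def relIndex (i j : Expr) : Expr := .add (.cell 2 i) j

theorem HasRows.eval_relIndex {I : CCInstance} {s : State} (h : HasRows I s) {i j : Expr}
    {u v : Fin I.n} (hi : i.eval s = u) (hj : j.eval s = v) :
    (relIndex i j).eval s = u * I.n + v := by
  simp only [relIndex, Expr.eval, hi, hj, h.row_eq u u.2.le]

theorem HasRows.eval_rel {I : CCInstance} {s : State} (h : HasRows I s) {i j : Expr}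
    {u v : Fin I.n} (hi : i.eval s = u) (hj : j.eval s = v) :
    (Expr.cell 3 (relIndex i j)).eval s ≠ 0 ↔ Rel I.n s u v := by
  rw [Expr.eval, h.eval_relIndex hi hj, Rel]

def realProg : Prog :=
  .forLoop 20 nExpr (.forLoop 21 nExpr
    (.assign 3 (relIndex (.reg 20) (.reg 21))
      (.add (adjExpr (.reg 20) (.reg 21)) (.not (.ne (.reg 20) (.reg 21))))))

theorem wp_realProg {I : CCInstance} {N : ℕ} {s : State} (hN : I.n ≤ N) (h : HasRows I s) :
    WP N realProg (fun s' => ∀ u v : Fin I.n, Rel I.n s' u v ↔ u = v ∨ I.graph.real.Adj u v)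
      s := by
  refine WP.forLoop I.n (fun j s' => ∀ u v : Fin I.n, u.val < j →
    (Rel I.n s' u v ↔ u = v ∨ I.graph.real.Adj u v)) hN (by decide)
    (fun s' hf => (h.congr (hf 0 (by decide)) (hf 2 (by decide))).n_eq)
    (fun j s' x hI => by rwa [Rel.congr_state (State.write_of_ne _ _ _ (by decide))])
    (by simp) ?_ (fun s' _ hI u v => hI u v u.2)
  intro j s₁ hj hj₁ hf₁ hI₁
  have h₁ := h.congr (hf₁ 0 (by decide)) (hf₁ 2 (by decide))
  refine WP.forLoop I.n (fun l s' => ∀ u v : Fin I.n, u.val < j ∨ u.val = j ∧ v.val < l →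
    (Rel I.n s' u v ↔ u = v ∨ I.graph.real.Adj u v)) hN (by decide)
    (fun s' hf => (h₁.congr (hf 0 (by decide)) (hf 2 (by decide))).n_eq)
    (fun j s' x hI => by rwa [Rel.congr_state (State.write_of_ne _ _ _ (by decide))])
    (fun u v huv => hI₁ u v (by omega)) ?_ (fun s' _ hI u v huv => hI u v (by omega))
  intro l s₂ hl hl₂ hf₂ hI₂
  have h₂ := h₁.congr (hf₂ 0 (by decide)) (hf₂ 2 (by decide))
  have hj₂ : (Expr.reg 20).eval s₂ = (⟨j, hj⟩ : Fin I.n) := by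
    simpa [Expr.eval, hf₂ 20 (by decide)] using hj₁
  have hl₂' : (Expr.reg 21).eval s₂ = (⟨l, hl⟩ : Fin I.n) := hl₂
  refine WP.assign fun u v huv => ?_
  rw [h₂.eval_relIndex hj₂ hl₂', Rel.write]
  split_ifs with hc
  · obtain ⟨rfl, rfl⟩ := hc
    have ha := h₂.eval_adjExpr hj₂ hl₂'
    have hn := Expr.eval_not_ne_zero (.ne (.reg 20) (.reg 21)) s₂
    rw [Expr.eval_ne_ne_zero, hj₂, hl₂', ne_eq, not_not, ← Fin.ext_iff] at hn
    rw [← ha, ← hn, Expr.eval]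
    omega
  · refine hI₂ u v ?_
    simp only [Fin.ext_iff] at hc
    omega

def warshallProg : Prog :=
  .forLoop 20 nExpr (.forLoop 21 nExpr (.forLoop 22 nExpr
    (.branch (.and (.cell 3 (relIndex (.reg 21) (.reg 20)))
        (.cell 3 (relIndex (.reg 20) (.reg 22))))
      (.assign 3 (relIndex (.reg 21) (.reg 22)) (.lit 1)) .skip)))

/-- One round of the Warshall algorithm has been done for the vertex pairs up to `(j, l)`. -/
structure WarshallRound {n : ℕ} (w : Fin n) (r₀ : Fin n → Fin n → Prop) (j l : ℕ)
    (r : Fin n → Fin n → Prop) : Prop where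
  le : ∀ u v, r₀ u v → r u v
  ge : ∀ u v, r u v → r₀ u v ∨ (r₀ u w ∧ r₀ w v)
  closed : ∀ u v : Fin n, (u.val < j ∨ u.val = j ∧ v.val < l) → r₀ u w → r₀ w v → r u v

/-- The invariant of the Warshall algorithm. -/
structure WarshallInv (I : CCInstance) (w : ℕ) (r : Fin I.n → Fin I.n → Prop) : Prop where
  sound : ∀ u v, r u v → I.graph.real.Reachable u v
  base : ∀ u v, u = v ∨ I.graph.real.Adj u v → r u v
  trans : ∀ x u v : Fin I.n, x.val < w → r u x → r x v → r u v

/-- A pair added in round `w` is composed of two old pairs through `w`. Hence a composition of new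
pairs reduces to old pairs and at most one passage through `w`. -/
theorem WarshallInv.step {I : CCInstance} {w : Fin I.n} {r₀ r : Fin I.n → Fin I.n → Prop}
    (h : WarshallInv I w r₀) {l : ℕ} (hr : WarshallRound w r₀ I.n l r) :
    WarshallInv I (w + 1) r where
  sound u v huv := by
    rcases hr.ge u v huv with h1 | ⟨h1, h2⟩
    · exact h.sound u v h1
    · exact (h.sound u w h1).trans (h.sound w v h2)
  base u v huv := hr.le u v (h.base u v huv)
  trans x u v hx hux hxv := by
    have hc : ∀ u v, r₀ u w → r₀ w v → r u v := fun u v => hr.closed u v (Or.inl u.2)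
    rcases hr.ge u x hux with h1 | ⟨h1, h2⟩ <;> rcases hr.ge x v hxv with h3 | ⟨h3, h4⟩
    · rcases Nat.lt_succ_iff_lt_or_eq.1 hx with hx | hx
      · exact hr.le u v (h.trans x u v hx h1 h3)
      · obtain rfl := Fin.ext hx
        exact hc u v h1 h3
    · rcases Nat.lt_succ_iff_lt_or_eq.1 hx with hx | hx
      · exact hc u v (h.trans x u w hx h1 h3) h4
      · obtain rfl := Fin.ext hx
        exact hc u v h1 h4
    · rcases Nat.lt_succ_iff_lt_or_eq.1 hx with hx | hx
      · exact hc u v h1 (h.trans x w v hx h2 h3)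
      · obtain rfl := Fin.ext hx
        exact hc u v h1 h3
    · exact hc u v h1 h4

theorem WarshallInv.iff_reachable {I : CCInstance} {r : Fin I.n → Fin I.n → Prop}
    (h : WarshallInv I I.n r) (u v : Fin I.n) : r u v ↔ I.graph.real.Reachable u v := by
  refine ⟨h.sound u v, fun huv => ?_⟩
  rw [SimpleGraph.reachable_iff_reflTransGen] at huv
  induction huv with
  | refl => exact h.base u u (Or.inl rfl)
  | @tail a b _ hab ih => exact h.trans a u b a.2 ih (h.base a b (Or.inr hab))

theorem wp_warshallProg {I : CCInstance} {N : ℕ} {s : State} (hN : I.n ≤ N) (h : HasRows I s)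
    (hs : ∀ u v : Fin I.n, Rel I.n s u v ↔ u = v ∨ I.graph.real.Adj u v) :
    WP N warshallProg (fun s' => ∀ u v : Fin I.n,
      Rel I.n s' u v ↔ I.graph.real.Reachable u v) s := by
  refine WP.forLoop I.n (fun w s' => WarshallInv I w (Rel I.n s')) hN (by decide)
    (fun s' hf => (h.congr (hf 0 (by decide)) (hf 2 (by decide))).n_eq)
    (fun j s' x hI => by rwa [Rel.congr_state (State.write_of_ne _ _ _ (by decide))])
    ⟨fun u v huv => ?_, fun u v => (hs u v).2, fun _ _ _ h0 => absurd h0 (by omega)⟩ ?_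
    (fun s' _ hI => hI.iff_reachable)
  · rcases (hs u v).1 huv with rfl | h1
    · exact SimpleGraph.Reachable.refl _
    · exact h1.reachable
  intro w s₁ hw hw₁ hf₁ hI₁
  have h₁ := h.congr (hf₁ 0 (by decide)) (hf₁ 2 (by decide))
  refine WP.forLoop I.n (fun j s' => WarshallRound ⟨w, hw⟩ (Rel I.n s₁) j 0 (Rel I.n s')) hN
    (by decide) (fun s' hf => (h₁.congr (hf 0 (by decide)) (hf 2 (by decide))).n_eq)
    (fun j s' x hI => by rwa [Rel.congr_state (State.write_of_ne _ _ _ (by decide))])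
    ⟨fun _ _ h => h, fun _ _ => Or.inl, fun _ _ h0 => absurd h0 (by omega)⟩ ?_
    (fun s' _ hI => WarshallInv.step (w := ⟨w, hw⟩) hI₁ hI)
  intro j s₂ hj hj₂ hf₂ hI₂
  have h₂ := h₁.congr (hf₂ 0 (by decide)) (hf₂ 2 (by decide))
  refine WP.forLoop I.n (fun l s' => WarshallRound ⟨w, hw⟩ (Rel I.n s₁) j l (Rel I.n s')) hN
    (by decide) (fun s' hf => (h₂.congr (hf 0 (by decide)) (hf 2 (by decide))).n_eq)
    (fun j s' x hI => by rwa [Rel.congr_state (State.write_of_ne _ _ _ (by decide))]) hI₂ ?_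
    (fun s' _ hI => ⟨hI.le, hI.ge, fun u v huv => hI.closed u v (by omega)⟩)
  intro l s₃ hl hl₃ hf₃ hI₃
  have h₃ := h₂.congr (hf₃ 0 (by decide)) (hf₃ 2 (by decide))
  have hw₃ : (Expr.reg 20).eval s₃ = (⟨w, hw⟩ : Fin I.n) := by
    simpa [Expr.eval, hf₃ 20 (by decide), hf₂ 20 (by decide)] using hw₁
  have hj₃ : (Expr.reg 21).eval s₃ = (⟨j, hj⟩ : Fin I.n) := by
    simpa [Expr.eval, hf₃ 21 (by decide)] using hj₂
  have hl₃' : (Expr.reg 22).eval s₃ = (⟨l, hl⟩ : Fin I.n) := hl₃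
  -- Row and column `w` do not change during round `w`, so updating the matrix in place is harmless.
  have hcol : ∀ u : Fin I.n, Rel I.n s₃ u ⟨w, hw⟩ → Rel I.n s₁ u ⟨w, hw⟩ := fun u hu =>
    (hI₃.ge _ _ hu).elim id And.left
  have hrow : ∀ u : Fin I.n, Rel I.n s₃ ⟨w, hw⟩ u → Rel I.n s₁ ⟨w, hw⟩ u := fun u hu =>
    (hI₃.ge _ _ hu).elim id And.right
  have hcond : (Expr.and (.cell 3 (relIndex (.reg 21) (.reg 20)))
        (.cell 3 (relIndex (.reg 20) (.reg 22)))).eval s₃ ≠ 0 ↔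
      Rel I.n s₃ ⟨j, hj⟩ ⟨w, hw⟩ ∧ Rel I.n s₃ ⟨w, hw⟩ ⟨l, hl⟩ := by
    rw [Expr.eval_and_ne_zero, h₃.eval_rel hj₃ hw₃, h₃.eval_rel hw₃ hl₃']
  refine WP.branch (fun hc => WP.assign ?_) (fun hc => WP.skip ?_)
  · have hc := hcond.1 hc
    rw [h₃.eval_relIndex hj₃ hl₃']
    refine ⟨fun u v huv => ?_, fun u v huv => ?_, fun u v huv h1 h2 => ?_⟩
    · rw [Rel.write]
      split_ifs
      · simp [Expr.eval]
      · exact hI₃.le u v huv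
    · rw [Rel.write] at huv
      split_ifs at huv with he
      · obtain ⟨rfl, rfl⟩ := he
        exact Or.inr ⟨hcol _ hc.1, hrow _ hc.2⟩
      · exact hI₃.ge u v huv
    · rw [Rel.write]
      split_ifs with he
      · simp [Expr.eval]
      · refine hI₃.closed u v ?_ h1 h2
        simp only [Fin.ext_iff] at he
        omega
  · refine ⟨hI₃.le, hI₃.ge, fun u v huv h1 h2 => ?_⟩
    by_cases he : u = ⟨j, hj⟩ ∧ v = ⟨l, hl⟩
    · obtain ⟨rfl, rfl⟩ := he
      exact absurd hc (hcond.2 ⟨hI₃.le _ _ h1, hI₃.le _ _ h2⟩)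
    · refine hI₃.closed u v ?_ h1 h2
      simp only [Fin.ext_iff] at he
      omega

/-! ### Computing the dirty vertices. -/

/-- Register `30` counts the ordered nonedges in the component. A nonedge is a pair of nonzero
weight that is not a real edge; this also excludes the diagonal. -/
def dirtyProg : Prog :=
  .forLoop 20 nExpr (.seq (.set 30 (.lit 0)) (.seq
    (.forLoop 21 nExpr (.forLoop 22 nExpr (.set 30 (.add (.reg 30)
      (.and (.and (.cell 3 (relIndex (.reg 20) (.reg 21)))
          (.cell 3 (relIndex (.reg 20) (.reg 22))))
        (.and (.not (adjExpr (.reg 21) (.reg 22))) (weightExpr (.reg 21) (.reg 22))))))))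
    (.assign 4 (.reg 20) (.reg 30))))

theorem wp_dirtyProg {I : CCInstance} {N : ℕ} {s : State} (hN : I.n ≤ N) (h : HasRows I s)
    (hs : ∀ u v : Fin I.n, Rel I.n s u v ↔ I.graph.real.Reachable u v) :
    WP N dirtyProg (fun s' => ∀ v : Fin I.n, s' 4 v ≠ 0 ↔ I.Dirty v) s := by
  classical
  refine WP.forLoop I.n (fun j s' => ∀ v : Fin I.n, v.val < j → (s' 4 v ≠ 0 ↔ I.Dirty v)) hN
    (by decide) (fun s' hf => (h.congr (hf 0 (by decide)) (hf 2 (by decide))).n_eq)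
    (fun j s' x hI => by rwa [State.write_of_ne _ _ _ (by decide)])
    (by simp) ?_ (fun s' _ hI v => hI v v.2)
  intro j s₁ hj hj₁ hf₁ hI₁
  have h₁ := h.congr (hf₁ 0 (by decide)) (hf₁ 2 (by decide))
  refine WP.seq (WP.assign (WP.seq ?_))
  set s₂ := s₁.write 30 ((Expr.lit 0).eval s₁) ((Expr.lit 0).eval s₁) with hs₂
  have hf₂ : ∀ b, b ≠ 30 → s₂ b = s₁ b := fun b hb => State.write_of_ne _ _ _ hb
  have h₂ := h₁.congr (hf₂ 0 (by decide)) (hf₂ 2 (by decide))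
  refine WP.sumLoop (acc := 30) (fun x : Fin I.n => ∑ y : Fin I.n,
      if I.graph.real.Reachable ⟨j, hj⟩ x ∧ I.graph.real.Reachable ⟨j, hj⟩ y ∧
        I.graph.IsNonedge x y then 1 else 0) hN (by decide) (by decide)
    (fun s' hf => (h₂.congr (hf 0 (by decide)) (hf 2 (by decide))).n_eq) ?_ ?_
  · intro x s₃ hx₃ hf₃
    have h₃ := h₂.congr (hf₃ 0 (by decide)) (hf₃ 2 (by decide))
    refine WP.sumLoop (acc := 30) _ hN (by decide) (by decide)
      (fun s' hf => (h₃.congr (hf 0 (by decide)) (hf 2 (by decide))).n_eq) ?_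
      (fun s' _ hI => hI)
    intro y s₄ hy₄ hf₄
    have h₄ := h₃.congr (hf₄ 0 (by decide)) (hf₄ 2 (by decide))
    have hj₄ : (Expr.reg 20).eval s₄ = (⟨j, hj⟩ : Fin I.n) := by
      simpa [Expr.eval, hf₄ 20 (by decide), hf₃ 20 (by decide), hf₂ 20 (by decide)] using hj₁
    have hx₄ : (Expr.reg 21).eval s₄ = x := by
      simpa [Expr.eval, hf₄ 21 (by decide)] using hx₃
    have hy₄' : (Expr.reg 22).eval s₄ = y := hy₄
    have hR : ∀ u v, Rel I.n s₄ u v ↔ I.graph.real.Reachable u v := by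
      rw [Rel.congr_state ((hf₄ 3 (by decide)).trans ((hf₃ 3 (by decide)).trans
        ((hf₂ 3 (by decide)).trans (hf₁ 3 (by decide)))))]
      exact hs
    refine WP.assign ?_
    rw [Expr.eval, State.write_same, if_pos rfl, Expr.eval]
    congr 1
    refine Expr.eval_and_eq_ite ?_
    rw [Expr.eval_and_ne_zero, Expr.eval_and_ne_zero, Expr.eval_and_ne_zero,
      Expr.eval_not_ne_zero, h₄.eval_rel hj₄ hx₄, h₄.eval_rel hj₄ hy₄', hR, hR,
      h₄.eval_weightExpr hx₄ hy₄', isNonedge_iff, h₄.eval_adjExpr hx₄ hy₄', and_assoc]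
  · intro s₃ hf₃ hsum
    have hj₃ : (Expr.reg 20).eval s₃ = j := by
      simpa [Expr.eval, hf₃ 20 (by decide), hf₂ 20 (by decide)] using hj₁
    refine WP.assign fun v hv => ?_
    rw [hj₃, State.write_same]
    split_ifs with hvj
    · obtain rfl : v = ⟨j, hj⟩ := Fin.ext hvj
      have h0 : s₂ 30 0 = 0 := by simp [hs₂, Expr.eval, State.write_same]
      rw [Expr.eval, Expr.eval, hsum, h0, zero_add]
      simp only [ne_eq, Finset.sum_eq_zero_iff, Finset.mem_univ, true_implies, not_forall]
      simp [Dirty]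
    · rw [hf₃ 4 (by decide), hf₂ 4 (by decide)]
      exact hI₁ v (by omega)

/-! ### Greedy choice of representatives. -/

def commonProg : Prog :=
  .seq (.set 30 (.lit 0)) (.forLoop 22 nExpr (.set 30 (.add (.reg 30)
    (.and (adjExpr (.reg 21) (.reg 22)) (adjExpr (.reg 20) (.reg 22))))))

theorem wp_commonProg {I : CCInstance} {N : ℕ} {s : State} (hN : I.n ≤ N) (h : HasRows I s)
    {u v : Fin I.n} (hu : s 21 0 = u) (hv : s 20 0 = v) :
    WP N commonProg (fun s' => s' 30 0 = I.common u v) s := by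
  classical
  refine WP.seq (WP.assign ?_)
  set s₂ := s.write 30 ((Expr.lit 0).eval s) ((Expr.lit 0).eval s) with hs₂
  have hf₂ : ∀ b, b ≠ 30 → s₂ b = s b := fun b hb => State.write_of_ne _ _ _ hb
  have h₂ := h.congr (hf₂ 0 (by decide)) (hf₂ 2 (by decide))
  refine WP.sumLoop (acc := 30) (fun x : Fin I.n =>
      if I.graph.real.Adj u x ∧ I.graph.real.Adj v x then 1 else 0) hN (by decide) (by decide)
    (fun s' hf => (h₂.congr (hf 0 (by decide)) (hf 2 (by decide))).n_eq) ?_ ?_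
  · intro x s₃ hx₃ hf₃
    have h₃ := h₂.congr (hf₃ 0 (by decide)) (hf₃ 2 (by decide))
    have hu₃ : (Expr.reg 21).eval s₃ = u := by
      simpa [Expr.eval, hf₃ 21 (by decide), hf₂ 21 (by decide)] using hu
    have hv₃ : (Expr.reg 20).eval s₃ = v := by
      simpa [Expr.eval, hf₃ 20 (by decide), hf₂ 20 (by decide)] using hv
    have hx₃' : (Expr.reg 22).eval s₃ = x := hx₃
    refine WP.assign ?_
    rw [Expr.eval, State.write_same, if_pos rfl, Expr.eval]
    congr 1
    refine Expr.eval_and_eq_ite ?_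
    rw [Expr.eval_and_ne_zero, h₃.eval_adjExpr hu₃ hx₃', h₃.eval_adjExpr hv₃ hx₃']
  · intro s₃ hf₃ hsum
    have h0 : s₂ 30 0 = 0 := by simp [hs₂, Expr.eval, State.write_same]
    rw [hsum, h0, zero_add, Finset.sum_boole, common, Nat.cast_id]

/-- The second test fails once the current vertex has been attached to an earlier one, so it keeps
the first representative found. The status of earlier vertices is final. -/
def repProg : Prog :=
  .forLoop 20 nExpr (.seq (.assign 5 (.reg 20) (.reg 20)) (.forLoop 21 (.reg 20)
    (.branch (.and (.not (.ne (.cell 5 (.reg 21)) (.reg 21)))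
        (.not (.ne (.cell 5 (.reg 20)) (.reg 20))))
      (.seq commonProg (.branch (.sub (.reg 30) kExpr) (.assign 5 (.reg 20) (.reg 21)) .skip))
      .skip)))

/-- The representative of `v` stored in bank `5` is correct. -/
def RepOK (I : CCInstance) (s : State) (v : Fin I.n) : Prop :=
  ∃ u : Fin I.n, s 5 v = u ∧ s 5 u = u ∧ u ≤ v ∧ (u = v ∨ I.k < I.common u v)

/-- If `u` and `v` are representatives, then they have few common neighbours. -/
def FewCommon (I : CCInstance) (s : State) (u v : Fin I.n) : Prop :=
  s 5 u = u → s 5 v = v → I.common u v ≤ I.k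

/-- The invariant for the choice of representatives. -/
structure RepInv (I : CCInstance) (j : ℕ) (s : State) : Prop where
  repOK : ∀ v : Fin I.n, v.val < j → RepOK I s v
  fewCommon : ∀ u v : Fin I.n, u < v → v.val < j → FewCommon I s u v

theorem RepInv.congr_state {I : CCInstance} {j : ℕ} {s s' : State} (h : RepInv I j s)
    (hs : ∀ v : Fin I.n, v.val < j → s' 5 v = s 5 v) : RepInv I j s' where
  repOK v hv := by
    obtain ⟨u, h1, h2, h3, h4⟩ := h.repOK v hv
    exact ⟨u, by rw [hs v hv, h1], by rw [hs u (lt_of_le_of_lt h3 hv), h2], h3, h4⟩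
  fewCommon u v huv hv := by
    have := h.fewCommon u v huv hv
    unfold FewCommon at *
    rwa [hs v hv, hs u (lt_trans huv hv)]

theorem wp_repProg {I : CCInstance} {N : ℕ} {s : State} (hN : I.n ≤ N) (h : HasRows I s) :
    WP N repProg (RepInv I I.n) s := by
  refine WP.forLoop I.n (RepInv I) hN (by decide)
    (fun s' hf => (h.congr (hf 0 (by decide)) (hf 2 (by decide))).n_eq)
    (fun j s' x hI => hI.congr_state fun v _ => by rw [State.write_of_ne _ _ _ (by decide)])
    ⟨fun _ h0 => absurd h0 (by omega), fun _ _ _ h0 => absurd h0 (by omega)⟩ ?_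
    (fun s' _ hI => hI)
  intro j s₁ hj hj₁ hf₁ hI₁
  have h₁ := h.congr (hf₁ 0 (by decide)) (hf₁ 2 (by decide))
  refine WP.seq (WP.assign ?_)
  simp only [Expr.eval, hj₁]
  set s₂ := s₁.write 5 j j with hs₂
  have hf₂ : ∀ b, b ≠ 5 → s₂ b = s₁ b := fun b hb => State.write_of_ne _ _ _ hb
  have h₂ := h₁.congr (hf₂ 0 (by decide)) (hf₂ 2 (by decide))
  have hj₂ : s₂ 20 0 = j := by rw [hf₂ 20 (by decide), hj₁]
  have hjj : s₂ 5 j = j := by simp [hs₂, State.write_same]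
  refine WP.forLoop j (fun l s' => RepInv I j s' ∧ RepOK I s' ⟨j, hj⟩ ∧
      ∀ u : Fin I.n, u.val < l → u.val < j → FewCommon I s' u ⟨j, hj⟩) (hj.le.trans hN) (by decide)
    (fun s' hf => by rw [Expr.eval, hf 20 (by decide)]; exact hj₂)
    (fun l s' x hI => by
      have h5 : s'.write 21 0 x 5 = s' 5 := State.write_of_ne _ _ _ (by decide)
      refine ⟨hI.1.congr_state fun v _ => by rw [h5], ?_⟩
      simpa only [RepOK, FewCommon, h5] using hI.2)
    ⟨hI₁.congr_state fun v hv => ?_, ⟨⟨j, hj⟩, hjj, hjj, le_rfl, Or.inl rfl⟩,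
      fun _ h0 => absurd h0 (by omega)⟩ ?_ ?_
  · rw [hs₂, State.write_same, if_neg (by omega)]
  · intro l s₃ hl hl₃ hf₃ hI₃
    have h₃ := h₂.congr (hf₃ 0 (by decide)) (hf₃ 2 (by decide))
    have hj₃ : s₃ 20 0 = j := by rw [hf₃ 20 (by decide), hj₂]
    have hln : l < I.n := hl.trans hj
    have hcond : (Expr.and (.not (.ne (.cell 5 (.reg 21)) (.reg 21)))
        (.not (.ne (.cell 5 (.reg 20)) (.reg 20)))).eval s₃ ≠ 0 ↔ s₃ 5 l = l ∧ s₃ 5 j = j := by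
      rw [Expr.eval_and_ne_zero, Expr.eval_not_ne_zero, Expr.eval_not_ne_zero,
        Expr.eval_ne_ne_zero, Expr.eval_ne_ne_zero]
      simp only [Expr.eval, hj₃, hl₃, ne_eq, not_not]
    have hnew : ∀ u : Fin I.n, u.val < l + 1 → u.val < l ∨ u = ⟨l, hln⟩ := fun u hu => by
      rw [Fin.ext_iff]
      exact Nat.lt_succ_iff_lt_or_eq.1 hu
    refine WP.branch (fun hc => WP.seq ?_) (fun hc => WP.skip ?_)
    · obtain ⟨hcl, hcj⟩ := hcond.1 hc
      refine (wp_commonProg hN h₃ (u := ⟨l, hln⟩) (v := ⟨j, hj⟩) hl₃ hj₃).mono ?_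
      intro s₄ hf₄ hcom
      have h₄ := h₃.congr (hf₄ 0 (by decide)) (hf₄ 2 (by decide))
      have h5 := hf₄ 5 (by decide)
      have hsub : (Expr.sub (.reg 30) kExpr).eval s₄ = I.common ⟨l, hln⟩ ⟨j, hj⟩ - I.k := by
        simp only [Expr.eval, hcom, h₄.k_eq]
      refine WP.branch (fun hlt => WP.assign ?_) (fun hle => WP.skip ?_)
      · rw [hsub] at hlt
        have hj₄ : (Expr.reg 20).eval s₄ = j := by
          rw [Expr.eval, hf₄ 20 (by decide)]
          exact hj₃
        have hl₄ : (Expr.reg 21).eval s₄ = l := by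
          rw [Expr.eval, hf₄ 21 (by decide)]
          exact hl₃
        have hval : ∀ v, s₄.write 5 j l 5 v = if v = j then l else s₃ 5 v := fun v => by
          rw [State.write_same, h5]
        rw [hj₄, hl₄]
        refine ⟨hI₃.1.congr_state fun v hv => ?_, ⟨⟨l, hln⟩, ?_, ?_, hl.le, Or.inr (by omega)⟩, ?_⟩
        · rw [hval, if_neg (by omega)]
        · rw [hval, if_pos rfl]
        · rw [hval, if_neg hl.ne, hcl]
        -- The vertex `j` is no longer a representative, so nothing is required of its common
        -- neighbours.
        · intro u _ _ _ hjr
          rw [hval, if_pos rfl] at hjr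
          simp only at hjr
          omega
      · rw [hsub] at hle
        refine ⟨hI₃.1.congr_state fun v _ => by rw [h5], by simpa only [RepOK, h5] using hI₃.2.1,
          fun u hu huj => ?_⟩
        rcases hnew u hu with hu | rfl
        · simpa only [FewCommon, h5] using hI₃.2.2 u hu huj
        · exact fun _ _ => by omega
    · refine ⟨hI₃.1, hI₃.2.1, fun u hu huj => ?_⟩
      rcases hnew u hu with hu | rfl
      · exact hI₃.2.2 u hu huj
      · exact fun h1 h2 => absurd hc (hcond.2 ⟨h1, h2⟩)
  · intro s₃ hf₃ hI₃
    refine ⟨fun v hv => ?_, fun u v huv hv => ?_⟩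
    · rcases Nat.lt_succ_iff_lt_or_eq.1 hv with hv | hv
      · exact hI₃.1.repOK v hv
      · obtain rfl : v = ⟨j, hj⟩ := Fin.ext hv
        exact hI₃.2.1
    · rcases Nat.lt_succ_iff_lt_or_eq.1 hv with hv | hv
      · exact hI₃.1.fewCommon u v huv hv
      · obtain rfl : v = ⟨j, hj⟩ := Fin.ext hv
        exact hI₃.2.2 u huv huv

def listProg : Prog :=
  .forLoop 20 nExpr (.branch (.and (.cell 4 (.reg 20))
      (.not (.ne (.cell 5 (.reg 20)) (.reg 20))))
    (.seq (.assign 6 (.reg 7) (.reg 20)) (.set 7 (.add (.reg 7) (.lit 1)))) .skip)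

/-- Bank `6` and register `7` contain a list and its length. -/
structure StoresList {n : ℕ} (s : State) (l : List (Fin n)) : Prop where
  length_eq : s 7 0 = l.length
  get_eq : ∀ i : Fin l.length, s 6 i = l.get i

theorem wp_listProg {I : CCInstance} {N : ℕ} {s : State} (hN : I.n ≤ N) (h : HasRows I s)
    (hs : s 7 0 = 0) :
    WP N listProg (fun s' => ∃ l : List (Fin I.n), l.Nodup ∧
      (∀ v : Fin I.n, v ∈ l ↔ s 4 v ≠ 0 ∧ s 5 v = v) ∧ StoresList s' l) s := by
  refine WP.forLoop I.n (fun j s' => ∃ l : List (Fin I.n), l.Nodup ∧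
      (∀ v : Fin I.n, v ∈ l ↔ v.val < j ∧ s 4 v ≠ 0 ∧ s 5 v = v) ∧ StoresList s' l) hN (by decide)
    (fun s' hf => (h.congr (hf 0 (by decide)) (hf 2 (by decide))).n_eq)
    (fun j s' x ⟨l, h1, h2, h3⟩ => ⟨l, h1, h2,
      by rw [State.write_of_ne _ _ _ (by decide), h3.length_eq],
      by rw [State.write_of_ne _ _ _ (by decide)]; exact h3.get_eq⟩)
    ⟨[], List.nodup_nil, by simp, hs, fun i => i.elim0⟩ ?_
    (fun s' _ ⟨l, h1, h2, h3⟩ => ⟨l, h1, by simpa using h2, h3⟩)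
  rintro j s₁ hj hj₁ hf₁ ⟨l, hl₁, hl₂, hl₃⟩
  have hcond : (Expr.and (.cell 4 (.reg 20)) (.not (.ne (.cell 5 (.reg 20)) (.reg 20)))).eval s₁
      ≠ 0 ↔ s 4 j ≠ 0 ∧ s 5 j = j := by
    rw [Expr.eval_and_ne_zero, Expr.eval_not_ne_zero, Expr.eval_ne_ne_zero]
    simp only [Expr.eval, hj₁, ne_eq, not_not, hf₁ 4 (by decide), hf₁ 5 (by decide)]
  refine WP.branch (fun hc => WP.seq (WP.assign (WP.assign ?_))) (fun hc => WP.skip ?_)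
  · refine ⟨l ++ [⟨j, hj⟩], ?_, ?_, ?_, ?_⟩
    · refine List.nodup_append.2 ⟨hl₁, List.nodup_singleton _, ?_⟩
      intro a ha b hb
      rw [List.mem_singleton.1 hb]
      rintro rfl
      exact absurd ((hl₂ _).1 ha).1 (lt_irrefl _)
    · intro v
      rw [List.mem_append, List.mem_singleton, hl₂, Fin.ext_iff, Nat.lt_succ_iff_lt_or_eq]
      have hc := hcond.1 hc
      constructor
      · rintro (h | h)
        · exact ⟨Or.inl h.1, h.2⟩
        · exact ⟨Or.inr h, by rwa [h]⟩
      · rintro ⟨h | h, h'⟩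
        · exact Or.inl ⟨h, h'⟩
        · exact Or.inr h
    · simp [Expr.eval, State.write_apply, hl₃.length_eq]
    · rintro ⟨i, hi⟩
      simp only [List.length_append, List.length_singleton] at hi
      simp only [Expr.eval, State.write_apply, hl₃.length_eq, hj₁, List.get_eq_getElem]
      by_cases hil : i < l.length
      · have := hl₃.get_eq ⟨i, hil⟩
        simp only [List.get_eq_getElem] at this
        simp [hil, hil.ne, this]
      · obtain rfl : i = l.length := by omega
        simp
  · refine ⟨l, hl₁, fun v => ?_, hl₃⟩
    rw [hl₂, Nat.lt_succ_iff_lt_or_eq]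
    constructor
    · exact fun h => ⟨Or.inl h.1, h.2⟩
    · rintro ⟨h | h, h'⟩
      · exact ⟨h, h'⟩
      · exact absurd hc (hcond.2 (by rwa [h] at h'))

/-! ### Sparsity of the fuzzy edges by deletion of minimum-degree vertices. -/

/-- The number of fuzzy edges from `v` to `S`. -/
def fuzzyDegree (I : CCInstance) (S : Finset (Fin I.n)) (v : Fin I.n) : ℕ :=
  (S.filter fun x => I.weight s(v, x) = 0 ∧ v ≠ x).card

theorem fuzzyDegree_mono (I : CCInstance) {S T : Finset (Fin I.n)} (h : S ⊆ T) (v : Fin I.n) :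
    I.fuzzyDegree S v ≤ I.fuzzyDegree T v :=
  Finset.card_le_card (Finset.filter_subset_filter _ h)

theorem exists_fuzzyDegree_le (I : CCInstance) {S : Finset (Fin I.n)} (hS : S.Nonempty) :
    ∃ v ∈ S, I.fuzzyDegree S v ≤ I.d := by
  classical
  obtain ⟨v, hv, h⟩ :=
    I.graph.fuzzy.hasDegeneracyOrdering_degeneracy.exists_degree_le hS
  refine ⟨v, hv, le_trans (Finset.card_le_card fun x hx => ?_) h⟩
  obtain ⟨hx, hw, hvx⟩ := Finset.mem_filter.1 hx
  exact Finset.mem_filter.2 ⟨hx, ((I.weight_eq_zero_iff v x).1 hw).resolve_left hvx⟩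

/-- Deleting `v` loses its own degree and `1` at each of its fuzzy neighbours. -/
theorem sum_fuzzyDegree_erase (I : CCInstance) {Q : Finset (Fin I.n)} {v : Fin I.n}
    (hv : v ∈ Q) : ∑ u ∈ Q, I.fuzzyDegree Q u ≤
      ∑ u ∈ Q.erase v, I.fuzzyDegree (Q.erase v) u + 2 * I.fuzzyDegree Q v := by
  rw [← Finset.add_sum_erase Q _ hv]
  have h1 : ∀ u, I.fuzzyDegree Q u ≤ I.fuzzyDegree (Q.erase v) u +
      if I.weight s(v, u) = 0 ∧ v ≠ u then 1 else 0 := by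
    intro u
    have h2 : (Q.filter fun x => I.weight s(u, x) = 0 ∧ u ≠ x) ⊆
        ((Q.erase v).filter fun x => I.weight s(u, x) = 0 ∧ u ≠ x) ∪
          if I.weight s(v, u) = 0 ∧ v ≠ u then {v} else ∅ := by
      intro x hx
      obtain ⟨hx, hw⟩ := Finset.mem_filter.1 hx
      by_cases hxv : x = v
      · subst hxv
        rw [Sym2.eq_swap, ne_comm] at hw
        simp [hw]
      · exact Finset.mem_union_left _ (Finset.mem_filter.2 ⟨Finset.mem_erase.2 ⟨hxv, hx⟩, hw⟩)
    refine (Finset.card_le_card h2).trans ((Finset.card_union_le _ _).trans ?_)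
    refine Nat.add_le_add_left ?_ _
    split_ifs <;> simp
  have h3 := Finset.sum_le_sum fun u (_ : u ∈ Q.erase v) => h1 u
  rw [Finset.sum_add_distrib, Finset.sum_boole] at h3
  have h4 : ((Q.erase v).filter fun u => I.weight s(v, u) = 0 ∧ v ≠ u).card ≤
      I.fuzzyDegree Q v := I.fuzzyDegree_mono (Finset.erase_subset _ _) v
  simp only [Nat.cast_id] at h3
  omega

def degreeProg : Prog :=
  .seq (.set 30 (.lit 0)) (.forLoop 22 nExpr (.set 30 (.add (.reg 30)
    (.and (.and (.not (.cell 8 (.reg 22))) (.not (weightExpr (.reg 21) (.reg 22))))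
      (.ne (.reg 21) (.reg 22))))))

/-- The vertices that are not marked in bank `8`. -/
def unmarked (I : CCInstance) (s : State) : Finset (Fin I.n) :=
  Finset.univ.filter fun v => s 8 v = 0

theorem wp_degreeProg {I : CCInstance} {N : ℕ} {s : State} (hN : I.n ≤ N) (h : HasRows I s)
    {v : Fin I.n} (hv : s 21 0 = v) :
    WP N degreeProg (fun s' => s' 30 0 = I.fuzzyDegree (I.unmarked s) v) s := by
  refine WP.seq (WP.assign ?_)
  set s₂ := s.write 30 ((Expr.lit 0).eval s) ((Expr.lit 0).eval s) with hs₂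
  have hf₂ : ∀ b, b ≠ 30 → s₂ b = s b := fun b hb => State.write_of_ne _ _ _ hb
  have h₂ := h.congr (hf₂ 0 (by decide)) (hf₂ 2 (by decide))
  refine WP.sumLoop (acc := 30) (fun x : Fin I.n =>
      if s 8 x = 0 ∧ I.weight s(v, x) = 0 ∧ v ≠ x then 1 else 0) hN (by decide) (by decide)
    (fun s' hf => (h₂.congr (hf 0 (by decide)) (hf 2 (by decide))).n_eq) ?_ ?_
  · intro x s₃ hx₃ hf₃
    have h₃ := h₂.congr (hf₃ 0 (by decide)) (hf₃ 2 (by decide))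
    have hv₃ : (Expr.reg 21).eval s₃ = v := by
      simpa [Expr.eval, hf₃ 21 (by decide), hf₂ 21 (by decide)] using hv
    have hx₃' : (Expr.reg 22).eval s₃ = x := hx₃
    have hm : (Expr.cell 8 (.reg 22)).eval s₃ = s 8 x := by
      rw [Expr.eval, hx₃', hf₃ 8 (by decide), hf₂ 8 (by decide)]
    refine WP.assign ?_
    rw [Expr.eval, State.write_same, if_pos rfl, Expr.eval]
    congr 1
    refine Expr.eval_and_eq_ite ?_
    rw [Expr.eval_and_ne_zero, Expr.eval_and_ne_zero, Expr.eval_not_ne_zero,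
      Expr.eval_not_ne_zero, Expr.eval_ne_ne_zero, hm, h₃.eval_weightExpr hv₃ hx₃', hv₃, hx₃',
      Ne, Ne, Ne, Ne, not_not, not_not, ← Fin.ext_iff, and_assoc]
  · intro s₃ hf₃ hsum
    have h0 : s₂ 30 0 = 0 := by simp [hs₂, Expr.eval, State.write_same]
    rw [hsum, h0, zero_add, Finset.sum_boole, fuzzyDegree, unmarked, Finset.filter_filter,
      Nat.cast_id]

/-- The start value `n + 1` exceeds every degree, so the first unmarked vertex replaces it. -/
def minDegreeProg : Prog :=
  .seq (.set 31 (.add nExpr (.lit 1))) (.forLoop 21 nExpr (.branch (.cell 8 (.reg 21)) .skip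
    (.seq degreeProg (.branch (.sub (.reg 31) (.reg 30))
      (.seq (.set 31 (.reg 30)) (.set 32 (.reg 21))) .skip))))

theorem wp_minDegreeProg {I : CCInstance} {N : ℕ} {s : State} (hN : I.n ≤ N) (h : HasRows I s)
    (hne : (I.unmarked s).Nonempty) :
    WP N minDegreeProg (fun s' => ∃ v ∈ I.unmarked s, s' 32 0 = v ∧
      s' 31 0 = I.fuzzyDegree (I.unmarked s) v ∧
      ∀ u ∈ I.unmarked s, I.fuzzyDegree (I.unmarked s) v ≤ I.fuzzyDegree (I.unmarked s) u) s := by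
  refine WP.seq (WP.assign ?_)
  set s₂ := s.write 31 ((Expr.lit 0).eval s) ((Expr.add nExpr (.lit 1)).eval s) with hs₂
  have hf₂ : ∀ b, b ≠ 31 → s₂ b = s b := fun b hb => State.write_of_ne _ _ _ hb
  have h₂ := h.congr (hf₂ 0 (by decide)) (hf₂ 2 (by decide))
  have h31 : s₂ 31 0 = I.n + 1 := by
    simp [hs₂, Expr.eval, State.write_same, h.n_eq]
  set A := I.unmarked s with hA
  refine WP.forLoop I.n (fun j s' =>
      (∀ u ∈ A, u.val < j → s' 31 0 ≤ I.fuzzyDegree A u) ∧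
      ((∀ u ∈ A, ¬ u.val < j) ∧ s' 31 0 = I.n + 1 ∨
        ∃ v ∈ A, s' 32 0 = v ∧ s' 31 0 = I.fuzzyDegree A v)) hN (by decide)
    (fun s' hf => (h₂.congr (hf 0 (by decide)) (hf 2 (by decide))).n_eq)
    (fun j s' x hI => by
      rwa [State.write_of_ne _ _ _ (by decide), State.write_of_ne _ _ _ (by decide)])
    ⟨fun _ _ h0 => absurd h0 (by omega), Or.inl ⟨fun _ _ => by omega, h31⟩⟩ ?_ ?_
  · intro j s₃ hj hj₃ hf₃ hI₃
    have h₃ := h₂.congr (hf₃ 0 (by decide)) (hf₃ 2 (by decide))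
    have h8 : s₃ 8 = s 8 := by rw [hf₃ 8 (by decide), hf₂ 8 (by decide)]
    have hA₃ : I.unmarked s₃ = A := by rw [hA, unmarked, unmarked, h8]
    have hmem : (Expr.cell 8 (.reg 21)).eval s₃ = 0 ↔ (⟨j, hj⟩ : Fin I.n) ∈ A := by
      simp [hA, unmarked, Expr.eval, hj₃, h8]
    have hnew : ∀ u ∈ A, u.val < j + 1 → u.val < j ∨ u = ⟨j, hj⟩ := fun u _ hu => by
      rw [Fin.ext_iff]
      exact Nat.lt_succ_iff_lt_or_eq.1 hu
    refine WP.branch (fun hc => WP.skip ?_) (fun hc => WP.seq ?_)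
    · have hj' : (⟨j, hj⟩ : Fin I.n) ∉ A := fun h' => hc (hmem.2 h')
      refine ⟨fun u hu huj => ?_, hI₃.2.imp_left fun h' => ⟨fun u hu huj => ?_, h'.2⟩⟩
      · rcases hnew u hu huj with h' | rfl
        · exact hI₃.1 u hu h'
        · exact absurd hu hj'
      · rcases hnew u hu huj with h'' | rfl
        · exact h'.1 u hu h''
        · exact absurd hu hj'
    · have hjA := hmem.1 hc
      refine (wp_degreeProg hN h₃ (v := ⟨j, hj⟩) hj₃).mono fun s₄ hf₄ hdeg => ?_
      rw [hA₃] at hdeg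
      have h31₄ : s₄ 31 = s₃ 31 := hf₄ 31 (by decide)
      have h32₄ : s₄ 32 = s₃ 32 := hf₄ 32 (by decide)
      have hsub : (Expr.sub (.reg 31) (.reg 30)).eval s₄ =
          s₃ 31 0 - I.fuzzyDegree A ⟨j, hj⟩ := by
        simp only [Expr.eval, hdeg, h31₄]
      refine WP.branch (fun hlt => WP.seq (WP.assign (WP.assign ?_))) (fun hle => WP.skip ?_)
      · rw [hsub] at hlt
        have e31 : ∀ s' : State, s' 31 0 = I.fuzzyDegree A ⟨j, hj⟩ → s' 32 0 = j →
            (∀ u ∈ A, u.val < j + 1 → s' 31 0 ≤ I.fuzzyDegree A u) ∧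
            ((∀ u ∈ A, ¬ u.val < j + 1) ∧ s' 31 0 = I.n + 1 ∨
              ∃ v ∈ A, s' 32 0 = v ∧ s' 31 0 = I.fuzzyDegree A v) := by
          intro s' h1 h2
          refine ⟨fun u hu huj => ?_, Or.inr ⟨_, hjA, h2, h1⟩⟩
          rcases hnew u hu huj with h' | rfl
          · have := hI₃.1 u hu h'
            omega
          · exact h1.le
        have hj₄ : s₄ 21 0 = j := by rw [hf₄ 21 (by decide), hj₃]
        refine e31 _ ?_ ?_ <;> simp [State.write_apply, Expr.eval, hdeg, hj₄]
      · rw [hsub] at hle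
        rw [h31₄, h32₄]
        refine ⟨fun u hu huj => ?_, Or.inr ?_⟩
        · rcases hnew u hu huj with h' | rfl
          · exact hI₃.1 u hu h'
          · omega
        · rcases hI₃.2 with h' | h'
          · exfalso
            have : I.fuzzyDegree A ⟨j, hj⟩ ≤ I.n :=
              (Finset.card_le_univ _).trans (Fintype.card_fin _).le
            omega
          · exact h'
  · intro s₃ hf₃ hI₃
    obtain ⟨u, hu⟩ := hne
    rcases hI₃.2 with h' | ⟨v, hv, h1, h2⟩
    · exact absurd u.2 (h'.1 u hu)
    · exact ⟨v, hv, h1, h2, fun w hw => h2 ▸ hI₃.1 w hw w.2⟩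

def peelProg : Prog :=
  .forLoop 20 nExpr (.seq minDegreeProg (.seq (.assign 8 (.reg 32) (.lit 1))
    (.branch (.sub (.reg 31) (.reg 9)) (.set 9 (.reg 31)) .skip)))

/-- Every vertex set `P` spans at most `q * #P` fuzzy edges (here each edge is counted twice). -/
def SparseFuzzy (I : CCInstance) (q : ℕ) : Prop :=
  ∀ P : Finset (Fin I.n), ∑ u ∈ P, I.fuzzyDegree P u ≤ 2 * q * P.card

/-- The invariant of the removal of vertices of minimum degree, where `A` is the set of the
remaining vertices. -/
structure PeelInv (I : CCInstance) (j : ℕ) (A : Finset (Fin I.n)) (q : ℕ) : Prop where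
  card_add : A.card + j = I.n
  le_d : q ≤ I.d
  sum_le : ∀ P : Finset (Fin I.n), ∑ u ∈ P, I.fuzzyDegree P u ≤
    ∑ u ∈ P ∩ A, I.fuzzyDegree (P ∩ A) u + 2 * q * (P \ A).card

/-- If `v ∈ P`, its deletion loses at most twice its degree in `P ∩ A`, which is at most its degree
in `A`. This minimum degree is at most `d` by degeneracy. -/
theorem PeelInv.step {I : CCInstance} {j : ℕ} {A : Finset (Fin I.n)} {q : ℕ}
    (h : PeelInv I j A q) {v : Fin I.n} (hv : v ∈ A)
    (hmin : ∀ u ∈ A, I.fuzzyDegree A v ≤ I.fuzzyDegree A u) :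
    PeelInv I (j + 1) (A.erase v) (max q (I.fuzzyDegree A v)) where
  card_add := by
    have := h.card_add
    have := Finset.card_pos.2 ⟨v, hv⟩
    rw [Finset.card_erase_of_mem hv]
    omega
  le_d := by
    obtain ⟨u, hu, hd⟩ := I.exists_fuzzyDegree_le ⟨v, hv⟩
    exact max_le h.le_d ((hmin u hu).trans hd)
  sum_le P := by
    refine (h.sum_le P).trans ?_
    have hq : ∀ x, 2 * q * x ≤ 2 * max q (I.fuzzyDegree A v) * x := fun x => by
      gcongr
      exact le_max_left _ _
    by_cases hvP : v ∈ P
    · have h1 : P ∩ A.erase v = (P ∩ A).erase v := Finset.inter_erase _ _ _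
      have h2 : P \ A.erase v = insert v (P \ A) := by
        ext x
        simp only [Finset.mem_sdiff, Finset.mem_erase, Finset.mem_insert]
        by_cases hx : x = v <;> simp_all
      have h3 := I.sum_fuzzyDegree_erase (Finset.mem_inter.2 ⟨hvP, hv⟩)
      have h4 := I.fuzzyDegree_mono (Finset.inter_subset_right : P ∩ A ⊆ A) v
      rw [h1, h2, Finset.card_insert_of_notMem (by simp [hv]), mul_add]
      have h5 := hq (P \ A).card
      have h6 := le_max_right q (I.fuzzyDegree A v)
      omega
    · have h1 : P ∩ A.erase v = P ∩ A := by
        rw [Finset.inter_erase, Finset.erase_eq_of_notMem (by simp [hvP])]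
      have h2 : P \ A.erase v = P \ A := by
        ext x
        simp only [Finset.mem_sdiff, Finset.mem_erase]
        by_cases hx : x = v <;> simp_all
      rw [h1, h2]
      exact Nat.add_le_add_left (hq _) _

theorem wp_peelProg {I : CCInstance} {N : ℕ} {s : State} (hN : I.n ≤ N) (h : HasRows I s)
    (h8 : ∀ i, s 8 i = 0) (h9 : s 9 0 = 0) :
    WP N peelProg (fun s' => s' 9 0 ≤ I.d ∧ I.SparseFuzzy (s' 9 0)) s := by
  refine WP.forLoop I.n (fun j s' => PeelInv I j (I.unmarked s') (s' 9 0)) hN (by decide)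
    (fun s' hf => (h.congr (hf 0 (by decide)) (hf 2 (by decide))).n_eq)
    (fun j s' x hI => by
      unfold unmarked at hI ⊢
      rwa [State.write_of_ne _ _ _ (by decide), State.write_of_ne _ _ _ (by decide)]) ?_ ?_ ?_
  · have : I.unmarked s = Finset.univ := by simp [unmarked, h8]
    rw [this, h9]
    exact ⟨by simp, Nat.zero_le _, fun P => by simp⟩
  · intro j s₁ hj hj₁ hf₁ hI₁
    have h₁ := h.congr (hf₁ 0 (by decide)) (hf₁ 2 (by decide))
    have hne : (I.unmarked s₁).Nonempty := by
      rw [← Finset.card_pos]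
      have := hI₁.card_add
      omega
    refine WP.seq ((wp_minDegreeProg hN h₁ hne).mono ?_)
    rintro s₂ hf₂ ⟨v, hv, h32, h31, hmin⟩
    have hstep := hI₁.step hv hmin
    have hfin : ∀ s' : State, (∀ i, s' 8 i = if i = v.val then 1 else s₁ 8 i) →
        s' 9 0 = max (s₁ 9 0) (I.fuzzyDegree (I.unmarked s₁) v) →
        PeelInv I (j + 1) (I.unmarked s') (s' 9 0) := by
      intro s' h1 h2
      have : I.unmarked s' = (I.unmarked s₁).erase v := by
        ext x
        by_cases hx : x = v
        · simp [unmarked, h1, hx]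
        · simp [unmarked, h1, hx, Fin.ext_iff.not.1 hx]
      rwa [this, h2]
    have h8₂ : s₂ 8 = s₁ 8 := hf₂ 8 (by decide)
    have h9₂ : s₂ 9 = s₁ 9 := hf₂ 9 (by decide)
    refine WP.seq (WP.assign (WP.branch (fun hc => WP.assign ?_) (fun hc => WP.skip ?_)))
    · simp only [Expr.eval, State.write_apply, h31, h32, h9₂] at hc
      norm_num at hc
      refine hfin _ (fun i => ?_) ?_
      · simp [State.write_apply, Expr.eval, h32, h8₂]
      · simp [State.write_apply, Expr.eval, h31]
        omega
    · simp only [Expr.eval, State.write_apply, h31, h32, h9₂] at hc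
      norm_num at hc
      refine hfin _ (fun i => ?_) ?_
      · simp [State.write_apply, Expr.eval, h32, h8₂]
      · simp [State.write_apply, h9₂]
        omega
  · intro s₁ _ hI₁
    refine ⟨hI₁.le_d, fun P => ?_⟩
    have hA : I.unmarked s₁ = ∅ := by
      have := hI₁.card_add
      exact Finset.card_eq_zero.1 (by omega)
    simpa [hA] using hI₁.sum_le P

/-! ### Class weights, unavoidable cost and size bound. -/

/-- The memory contains a choice of representatives. -/
structure Stores {I : CCInstance} {m : ℕ} (M : Merging I m) (s : State) : Prop
    extends HasRows I s where
  rep_eq : ∀ v : Fin I.n, s 5 v = M.rep v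
  L_eq : ∀ a : Fin m, s 6 a = M.L a
  m_eq : s 7 0 = m

theorem Stores.congr {I : CCInstance} {m : ℕ} {M : Merging I m} {s s' : State} (h : Stores M s)
    (h0 : s' 0 = s 0) (h2 : s' 2 = s 2) (h5 : s' 5 = s 5) (h6 : s' 6 = s 6) (h7 : s' 7 = s 7) :
    Stores M s' :=
  { h.toHasRows.congr h0 h2 with
    rep_eq := by simpa only [h5] using h.rep_eq
    L_eq := by simpa only [h6] using h.L_eq
    m_eq := by rw [h7, h.m_eq] }

theorem common_comm (I : CCInstance) (u v : Fin I.n) : I.common u v = I.common v u := by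
  unfold common
  congr 1
  ext x
  simp [and_comm]

theorem exists_stores {I : CCInstance} {s : State} (h : HasRows I s)
    (hdirty : ∀ v : Fin I.n, s 4 v ≠ 0 ↔ I.Dirty v) (hrep : RepInv I I.n s)
    {l : List (Fin I.n)} (hl : l.Nodup) (hmem : ∀ v : Fin I.n, v ∈ l ↔ s 4 v ≠ 0 ∧ s 5 v = v)
    (hs : StoresList s l) : ∃ M : Merging I l.length, Stores M s := by
  choose rep h1 h2 h3 h4 using fun v : Fin I.n => hrep.repOK v v.2
  have hfix : ∀ v : Fin I.n, rep v = v ↔ s 5 v = v := fun v => by rw [h1, Fin.ext_iff]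
  refine ⟨⟨rep, l.get, fun v => (hfix _).2 (h2 v), h4, fun u v huv hu hv => ?_,
    List.nodup_iff_injective_get.1 hl, fun v => ?_⟩,
    { h with rep_eq := h1, L_eq := hs.get_eq, m_eq := hs.length_eq }⟩
  · rw [hfix] at hu hv
    rcases lt_or_gt_of_ne huv with h' | h'
    · exact hrep.fewCommon u v h' v.2 hu hv
    · rw [common_comm]
      exact hrep.fewCommon v u h' u.2 hv hu
  · rw [← List.mem_iff_get, hmem, hdirty, hfix, and_comm]

/-- Store in register `acc` the total weight of the pairs of vertices, in the classes given by the
registers `20` and `21`, that satisfy the condition `c` on the registers `22` and `23`. -/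
def pairSumProg (acc : ℕ) (c : Expr) : Prog :=
  .seq (.set acc (.lit 0)) (.forLoop 22 nExpr (.forLoop 23 nExpr (.branch
    (.and (.and (.not (.ne (.cell 5 (.reg 22)) (.cell 6 (.reg 20))))
      (.not (.ne (.cell 5 (.reg 23)) (.cell 6 (.reg 21))))) c)
    (.set acc (.add (.reg acc) (weightExpr (.reg 22) (.reg 23)))) .skip)))

theorem wp_pairSumProg {I : CCInstance} {m : ℕ} {M : Merging I m} {N acc : ℕ} {c : Expr}
    {s : State} {a b : Fin m} (hN : I.n ≤ N) (h : Stores M s) (ha : s 20 0 = a) (hb : s 21 0 = b)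
    (hacc : acc ∈ [10, 11]) (p : Fin I.n → Fin I.n → Prop) [∀ u v, Decidable (p u v)]
    (hc : ∀ s' (u v : Fin I.n), HasRows I s' → (Expr.reg 22).eval s' = u →
      (Expr.reg 23).eval s' = v → (c.eval s' ≠ 0 ↔ p u v)) :
    WP N (pairSumProg acc c) (fun s' => s' acc 0 = ∑ u, ∑ v,
      if M.rep u = M.L a ∧ M.rep v = M.L b ∧ p u v then I.weight s(u, v) else 0) s := by
  -- As `acc` and the condition are variables, `decide` cannot evaluate the list of written banks;
  -- these frame conditions replace it.
  have hw : ∀ e : Expr, ∀ b, b ≠ acc → b ≠ 22 → b ≠ 23 →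
      b ∉ 22 :: (Prog.forLoop 23 nExpr (.branch e
        (.set acc (.add (.reg acc) (weightExpr (.reg 22) (.reg 23)))) .skip)).writes ∧
      (b ∉ 23 :: (Prog.branch e
        (.set acc (.add (.reg acc) (weightExpr (.reg 22) (.reg 23)))) .skip).writes) := by
    intro e b h1 h2 h3
    simp [Prog.forLoop, Prog.writes, h1, h2, h3]
  have hne : ∀ b, b ∉ [10, 11] → b ≠ acc := fun b hb hb' => hb (hb' ▸ hacc)
  refine WP.seq (WP.assign ?_)
  set s₂ := s.write acc ((Expr.lit 0).eval s) ((Expr.lit 0).eval s) with hs₂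
  have hf₂ : ∀ b, b ≠ acc → s₂ b = s b := fun b hb => State.write_of_ne _ _ _ hb
  have h₂ : Stores M s₂ := by
    apply h.congr <;> exact hf₂ _ (hne _ (by decide))
  refine WP.sumLoop (acc := acc) (fun u : Fin I.n => ∑ v : Fin I.n,
      if M.rep u = M.L a ∧ M.rep v = M.L b ∧ p u v then I.weight s(u, v) else 0) hN
    (by have := hne 22 (by decide); simp [Prog.forLoop, Prog.writes, this])
    (hne 22 (by decide)).symm
    (fun s' hf => by
      rw [← h.n_eq, Expr.eval, hf 0 (hw _ _ (hne _ (by decide)) (by decide) (by decide)).1,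
        hf₂ 0 (hne _ (by decide))]; rfl) ?_ ?_
  · intro u s₃ hu₃ hf₃
    have hf₃' : ∀ b, b ∉ [10, 11, 22, 23] → s₃ b = s₂ b := fun b hb => by
      simp only [List.mem_cons, not_or] at hb
      exact hf₃ b (hw _ _ (hne _ (by simp [hb])) hb.2.2.1 hb.2.2.2.1).1
    have h₃ : Stores M s₃ := by apply h₂.congr <;> exact hf₃' _ (by decide)
    refine WP.sumLoop (acc := acc) _ hN
      (by have := hne 23 (by decide); simp [Prog.writes, this]) (hne 23 (by decide)).symm
      (fun s' hf => by
        rw [← h₃.n_eq, Expr.eval, hf 0 (hw _ _ (hne _ (by decide)) (by decide) (by decide)).2]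
        rfl) ?_ (fun s' _ hI => hI)
    intro v s₄ hv₄ hf₄
    have hf₄' : ∀ b, b ∉ [10, 11, 23] → s₄ b = s₃ b := fun b hb => by
      by_cases h22 : b = 22
      · refine hf₄ b ?_
        have := hne 22 (by decide)
        simp [Prog.writes, h22, this]
      · simp only [List.mem_cons, not_or] at hb
        exact hf₄ b (hw _ _ (hne _ (by simp [hb])) h22 hb.2.2.1).2
    have h₄ : Stores M s₄ := by apply h₃.congr <;> exact hf₄' _ (by decide)
    have hu₄ : (Expr.reg 22).eval s₄ = u := by
      simpa [Expr.eval, hf₄' 22 (by decide)] using hu₃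
    have hv₄' : (Expr.reg 23).eval s₄ = v := hv₄
    have ha₄ : s₄ 20 0 = a := by
      rw [hf₄' 20 (by decide), hf₃' 20 (by decide), hf₂ 20 (hne _ (by decide)), ha]
    have hb₄ : s₄ 21 0 = b := by
      rw [hf₄' 21 (by decide), hf₃' 21 (by decide), hf₂ 21 (hne _ (by decide)), hb]
    have e₁ : (Expr.cell 5 (.reg 22)).eval s₄ = M.rep u := by
      rw [Expr.eval, hu₄, h₄.rep_eq]
    have e₂ : (Expr.cell 5 (.reg 23)).eval s₄ = M.rep v := by
      rw [Expr.eval, hv₄', h₄.rep_eq]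
    have e₃ : (Expr.cell 6 (.reg 20)).eval s₄ = M.L a := by
      simp only [Expr.eval, ha₄, h₄.L_eq]
    have e₄ : (Expr.cell 6 (.reg 21)).eval s₄ = M.L b := by
      simp only [Expr.eval, hb₄, h₄.L_eq]
    have hcond : (Expr.and (.and (.not (.ne (.cell 5 (.reg 22)) (.cell 6 (.reg 20))))
        (.not (.ne (.cell 5 (.reg 23)) (.cell 6 (.reg 21))))) c).eval s₄ ≠ 0 ↔
        M.rep u = M.L a ∧ M.rep v = M.L b ∧ p u v := by
      rw [Expr.eval_and_ne_zero, Expr.eval_and_ne_zero, Expr.eval_not_ne_zero,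
        Expr.eval_not_ne_zero, Expr.eval_ne_ne_zero, Expr.eval_ne_ne_zero,
        hc s₄ u v h₄.toHasRows hu₄ hv₄', e₁, e₂, e₃, e₄, Ne, Ne, not_not, not_not,
        ← Fin.ext_iff, ← Fin.ext_iff, and_assoc]
    refine WP.branch (fun h' => WP.assign ?_) (fun h' => WP.skip ?_)
    · rw [if_pos (hcond.1 h'), Expr.eval, State.write_same, if_pos rfl, Expr.eval,
        h₄.eval_weightExpr hu₄ hv₄', Expr.eval, Expr.eval]
    · rw [if_neg fun h'' => hcond.2 h'' h', add_zero]
  · intro s₃ hf₃ hsum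
    have h0 : s₂ acc 0 = 0 := by simp [hs₂, Expr.eval, State.write_same]
    rw [hsum, h0, zero_add]

def pairProg : Prog :=
  .seq (pairSumProg 10 (adjExpr (.reg 22) (.reg 23)))
    (pairSumProg 11 (.not (adjExpr (.reg 22) (.reg 23))))

theorem wp_pairProg {I : CCInstance} {m : ℕ} {M : Merging I m} {N : ℕ} {s : State} {a b : Fin m}
    (hN : I.n ≤ N) (h : Stores M s) (ha : s 20 0 = a) (hb : s 21 0 = b) :
    WP N pairProg (fun s' => s' 10 0 = M.pos a b ∧ s' 11 0 = M.neg a b) s := by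
  classical
  refine WP.seq ((wp_pairSumProg hN h ha hb (by decide) (fun u v => I.graph.real.Adj u v)
    fun s' u v hs' hu hv => hs'.eval_adjExpr hu hv).mono fun s₁ hf₁ h₁ => ?_)
  have hs₁ : Stores M s₁ := by apply h.congr <;> exact hf₁ _ (by decide)
  refine (wp_pairSumProg hN hs₁ (by rw [hf₁ 20 (by decide), ha])
    (by rw [hf₁ 21 (by decide), hb]) (by decide) (fun u v => ¬ I.graph.real.Adj u v)
    fun s' u v hs' hu hv => ?_).mono fun s₂ hf₂ h₂ => ⟨?_, ?_⟩
  · rw [Expr.eval_not_ne_zero, hs'.eval_adjExpr hu hv]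
  · rw [hf₂ 10 (by decide), h₁, Merging.pos]
  · rw [h₂, Merging.neg]

def totalProg : Prog :=
  .forLoop 20 (.reg 7) (.forLoop 21 (.reg 7) (.seq pairProg
    (.branch (.ne (.reg 20) (.reg 21))
      (.set 12 (.add (.reg 12) (.min (.reg 10) (.reg 11))))
      (.set 12 (.add (.reg 12) (.reg 11))))))

theorem Merging.m_le {I : CCInstance} {m : ℕ} (M : Merging I m) : m ≤ I.n := by
  simpa using Fintype.card_le_of_injective _ M.injective

theorem wp_totalProg {I : CCInstance} {m : ℕ} {M : Merging I m} {N : ℕ} {s : State}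
    (hN : I.n ≤ N) (h : Stores M s) (hs : s 12 0 = 0) :
    WP N totalProg (fun s' => s' 12 0 = M.total) s := by
  have hm := M.m_le.trans hN
  refine WP.sumLoop (acc := 12) (fun a : Fin m => ∑ b : Fin m,
      if a = b then M.neg a b else min (M.pos a b) (M.neg a b)) hm (by decide) (by decide)
    (fun s' hf => by rw [Expr.eval, hf 7 (by decide)]; exact h.m_eq) ?_
    (fun s' _ hI => by rw [hI, hs, zero_add, Merging.total])
  intro a s₁ ha₁ hf₁
  have h₁ : Stores M s₁ := by apply h.congr <;> exact hf₁ _ (by decide)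
  refine WP.sumLoop (acc := 12) _ hm (by decide) (by decide)
    (fun s' hf => by rw [Expr.eval, hf 7 (by decide)]; exact h₁.m_eq) ?_ (fun s' _ hI => hI)
  intro b s₂ hb₂ hf₂
  have h₂ : Stores M s₂ := by apply h₁.congr <;> exact hf₂ _ (by decide)
  have ha₂ : s₂ 20 0 = a := by rw [hf₂ 20 (by decide), ha₁]
  refine WP.seq ((wp_pairProg hN h₂ ha₂ hb₂).mono ?_)
  rintro s₃ hf₃ ⟨hpos, hneg⟩
  have hcond := Expr.eval_ne_ne_zero (.reg 20) (.reg 21) s₃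
  simp only [Expr.eval, hf₃ 20 (by decide), hf₃ 21 (by decide), ha₂, hb₂] at hcond
  rw [Ne, Ne, not_iff_not, ← Fin.ext_iff] at hcond
  refine WP.branch (fun hc => WP.assign ?_) (fun hc => WP.assign ?_)
  · rw [if_neg (hcond.not.1 hc), Expr.eval, State.write_same, if_pos rfl, Expr.eval,
      Expr.eval_min]
    simp only [Expr.eval, hpos, hneg, hf₃ 12 (by decide)]
  · rw [if_pos (hcond.1 hc), Expr.eval, State.write_same, if_pos rfl]
    simp only [Expr.eval, hneg, hf₃ 12 (by decide)]

/-- The product is computed by repeated addition. The budget is given in binary and may be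
exponentially large, so it is first replaced by `κ = min k n`. Register `15` becomes `8q + 2κ + 4`,
and twice this is added `κ` times. -/
def boundProg : Prog :=
  .seq (.set 14 (.min kExpr nExpr)) (.seq
    (.set 15 (.add (.add (.add (.reg 9) (.reg 9)) (.add (.reg 9) (.reg 9))) (.reg 14)))
    (.seq (.set 15 (.add (.add (.reg 15) (.reg 15)) (.lit 4)))
      (.forLoop 20 (.reg 14) (.set 13 (.add (.reg 13) (.add (.reg 15) (.reg 15)))))))

theorem wp_boundProg {I : CCInstance} {N : ℕ} {s : State} (hN : I.n ≤ N) (h : HasRows I s)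
    (hs : s 13 0 = 0) :
    WP N boundProg (fun s' => s' 13 0 =
      min I.k I.n * (16 * s 9 0 + 4 * min I.k I.n + 8)) s := by
  refine WP.seq (WP.assign (WP.seq (WP.assign (WP.seq (WP.assign ?_)))))
  have hk : (Expr.min kExpr nExpr).eval s = min I.k I.n := by
    rw [Expr.eval_min]
    simp only [Expr.eval, h.k_eq, h.n_eq]
  rw [hk]
  refine WP.sumLoop (acc := 13) (n := min I.k I.n)
    (fun _ => 16 * s 9 0 + 4 * min I.k I.n + 8) ((min_le_right _ _).trans hN) (by decide)
    (by decide) (fun s' hf => ?_) (fun x s' hx hf => WP.assign ?_) (fun s' hf hI => ?_)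
  · rw [Expr.eval, hf 14 (by decide)]
    simp [State.write_apply, Expr.eval]
  · rw [Expr.eval, State.write_same, if_pos rfl, Expr.eval]
    congr 1
    simp only [Expr.eval, hf 15 (by decide)]
    simp [State.write_apply]
    ring
  · rw [hI]
    simp [State.write_apply, hs]

/-! ### Writing the output. -/

def outputWeightsProg : Prog :=
  .forLoop 20 (.reg 7) (.forLoop 21 (.reg 7) (.seq pairProg
    (.branch (.ne (.reg 20) (.reg 21))
      (.push (.min (.add (.sub (.reg 10) (.reg 11)) (.sub (.reg 11) (.reg 10)))
        (.add (.add kExpr kExpr) (.lit 1))))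
      (.push (.lit 0)))))

def outputAdjProg : Prog :=
  .forLoop 20 (.reg 7) (.forLoop 21 (.reg 7) (.seq pairProg
    (.branch (.and (.ne (.reg 20) (.reg 21)) (.sub (.reg 10) (.reg 11)))
      (.push (.lit 1)) (.push (.lit 0)))))

theorem output_congr {s s' : State} (h : s' 1 = s 1) : output s' = output s := by
  unfold output
  rw [h]

theorem wp_outputWeightsProg {I : CCInstance} {m : ℕ} {M : Merging I m} {N : ℕ} {s : State}
    (hN : I.n ≤ N) (h : Stores M s) :
    WP N outputWeightsProg (fun s' => output s' = output s ++
      (List.finRange m).flatMap fun a => (List.finRange m).flatMap fun b =>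
        [M.merged.weight s(a, b)]) s := by
  have hm := M.m_le.trans hN
  refine WP.outputLoop (n := m) _ hm (by decide) (by decide)
    (fun s' hf => by rw [Expr.eval, hf 7 (by decide)]; exact h.m_eq) ?_ (fun s' _ hI => hI)
  intro a s₁ ha₁ hf₁
  have h₁ : Stores M s₁ := by apply h.congr <;> exact hf₁ _ (by decide)
  refine WP.outputLoop (n := m) _ hm (by decide) (by decide)
    (fun s' hf => by rw [Expr.eval, hf 7 (by decide)]; exact h₁.m_eq) ?_ (fun s' _ hI => hI)
  intro b s₂ hb₂ hf₂
  have h₂ : Stores M s₂ := by apply h₁.congr <;> exact hf₂ _ (by decide)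
  have ha₂ : s₂ 20 0 = a := by rw [hf₂ 20 (by decide), ha₁]
  refine WP.seq ((wp_pairProg hN h₂ ha₂ hb₂).mono ?_)
  rintro s₃ hf₃ ⟨hpos, hneg⟩
  have hcond := Expr.eval_ne_ne_zero (.reg 20) (.reg 21) s₃
  simp only [Expr.eval, hf₃ 20 (by decide), hf₃ 21 (by decide), ha₂, hb₂] at hcond
  rw [Ne, Ne, not_iff_not, ← Fin.ext_iff] at hcond
  have h₃ := h₂.toHasRows.congr (hf₃ 0 (by decide)) (hf₃ 2 (by decide))
  have ho := output_congr (hf₃ 1 (by decide))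
  refine WP.branch (fun hc => WP.push fun s₄ _ h₄ => ?_) (fun hc => WP.push fun s₄ _ h₄ => ?_)
  · rw [h₄, ho, Merging.merged_weight, if_neg (hcond.not.1 hc), Expr.eval_min]
    simp only [Expr.eval, hpos, hneg, h₃.k_eq]
  · rw [h₄, ho, Merging.merged_weight, if_pos (hcond.1 hc), Expr.eval]

open Classical in
theorem wp_outputAdjProg {I : CCInstance} {m : ℕ} {M : Merging I m} {N : ℕ} {s : State}
    (hN : I.n ≤ N) (h : Stores M s) :
    WP N outputAdjProg (fun s' => output s' = output s ++
      (List.finRange m).flatMap fun a => (List.finRange m).flatMap fun b =>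
        [if M.merged.graph.real.Adj a b then 1 else 0]) s := by
  have hm := M.m_le.trans hN
  refine WP.outputLoop (n := m) _ hm (by decide) (by decide)
    (fun s' hf => by rw [Expr.eval, hf 7 (by decide)]; exact h.m_eq) ?_ (fun s' _ hI => hI)
  intro a s₁ ha₁ hf₁
  have h₁ : Stores M s₁ := by apply h.congr <;> exact hf₁ _ (by decide)
  refine WP.outputLoop (n := m) _ hm (by decide) (by decide)
    (fun s' hf => by rw [Expr.eval, hf 7 (by decide)]; exact h₁.m_eq) ?_ (fun s' _ hI => hI)
  intro b s₂ hb₂ hf₂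
  have h₂ : Stores M s₂ := by apply h₁.congr <;> exact hf₂ _ (by decide)
  have ha₂ : s₂ 20 0 = a := by rw [hf₂ 20 (by decide), ha₁]
  refine WP.seq ((wp_pairProg hN h₂ ha₂ hb₂).mono ?_)
  rintro s₃ hf₃ ⟨hpos, hneg⟩
  have ho := output_congr (hf₃ 1 (by decide))
  have hcond : (Expr.and (.ne (.reg 20) (.reg 21)) (.sub (.reg 10) (.reg 11))).eval s₃ ≠ 0 ↔
      M.merged.graph.real.Adj a b := by
    rw [Expr.eval_and_ne_zero, Expr.eval_ne_ne_zero, Merging.merged_adj]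
    simp only [Expr.eval, hf₃ 20 (by decide), hf₃ 21 (by decide), ha₂, hb₂, hpos, hneg, Ne,
      Fin.ext_iff]
    omega
  refine WP.branch (fun hc => WP.push fun s₄ _ h₄ => ?_) (fun hc => WP.push fun s₄ _ h₄ => ?_)
  · rw [h₄, ho, if_pos (hcond.1 hc), Expr.eval]
  · rw [h₄, ho, if_neg fun h' => hcond.2 h' hc, Expr.eval]

/-- The sum of the two truncated differences is nonzero if and only if the unavoidable cost exceeds
`k` or there are too many classes. -/
def outputProg : Prog :=
  .branch (.add (.sub (.half (.reg 12)) kExpr) (.sub (.reg 7) (.reg 13)))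
    (.pushList [3, 0, 0, 1, 1, 1, 0, 1, 1, 1, 0, 0, 1, 0, 1, 0, 1, 0, 1, 0])
    (.seq (.push (.reg 7)) (.seq (.push (.sub kExpr (.half (.reg 12))))
      (.seq outputWeightsProg outputAdjProg)))

open Classical in
theorem code_eq_flatMap (I : CCInstance) : I.code = I.n :: I.k ::
    (((List.finRange I.n).flatMap fun a => (List.finRange I.n).flatMap fun b =>
        [I.weight s(a, b)]) ++
      (List.finRange I.n).flatMap fun a => (List.finRange I.n).flatMap fun b =>
        [if I.graph.real.Adj a b then 1 else 0]) := by
  simp only [code, List.map_eq_flatMap]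

theorem wp_outputProg {I : CCInstance} {m : ℕ} {M : Merging I m} {N : ℕ} {s : State}
    (hN : I.n ≤ N) (h : Stores M s) (hs : output s = []) (ht : s 12 0 = M.total) :
    WP N outputProg (fun s' =>
      (M.total / 2 ≤ I.k ∧ m ≤ s 13 0 ∧ output s' = M.merged.code) ∨
        (¬ (M.total / 2 ≤ I.k ∧ m ≤ s 13 0) ∧ output s' = no.code)) s := by
  have hcond : (Expr.add (.sub (.half (.reg 12)) kExpr) (.sub (.reg 7) (.reg 13))).eval s =
      (M.total / 2 - I.k) + (m - s 13 0) := by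
    simp only [Expr.eval, ht, h.k_eq, h.m_eq]
  refine WP.branch (fun hc => WP.pushList _ fun s₁ h₁ => ?_) (fun hc => WP.seq (WP.push ?_))
  · rw [hcond] at hc
    exact Or.inr ⟨by omega, by rw [h₁, hs, code_no, List.nil_append]⟩
  rw [hcond] at hc
  intro s₁ hf₁ ho₁
  refine WP.seq (WP.push fun s₂ hf₂ ho₂ => ?_)
  have h₁ : Stores M s₁ := by apply h.congr <;> exact hf₁ _ (by decide)
  have h₂ : Stores M s₂ := by apply h₁.congr <;> exact hf₂ _ (by decide)
  refine WP.seq ((wp_outputWeightsProg hN h₂).mono fun s₃ hf₃ ho₃ => ?_)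
  have h₃ : Stores M s₃ := by apply h₂.congr <;> exact hf₃ _ (by decide)
  refine (wp_outputAdjProg hN h₃).mono fun s₄ hf₄ ho₄ => Or.inl ⟨by omega, by omega, ?_⟩
  rw [ho₄, ho₃, ho₂, ho₁, hs]
  simp only [Expr.eval, h.m_eq, h₁.k_eq, hf₁ 12 (by decide), ht, List.nil_append,
    List.cons_append]
  exact M.merged.code_eq_flatMap.symm

/-! ### Decoding the initial memory. -/

theorem getD_flatMap {α : Type} (f : α → List ℕ) {n : ℕ} (hf : ∀ a, (f a).length = n)
    (l : List α) (i j : ℕ) (hi : i < l.length) (hj : j < n) (l' : List ℕ) :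
    (l.flatMap f ++ l').getD (i * n + j) 0 = (f l[i]).getD j 0 := by
  induction l generalizing i with
  | nil => simp at hi
  | cons a l ih =>
    rw [List.flatMap_cons, List.append_assoc]
    cases i with
    | zero => rw [List.getD_append _ _ _ _ (by simpa [hf] using hj)]; simp
    | succ i =>
      rw [List.getD_append_right _ _ _ _ (by rw [hf]; nlinarith), hf]
      have : (i + 1) * n + j - n = i * n + j := by
        rw [add_mul, one_mul]
        omega
      rw [this, ih i (by simpa using hi)]
      simp

theorem getD_flatMap_finRange {n : ℕ} (f : Fin n → Fin n → ℕ) (u v : Fin n) (l' : List ℕ) :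
    (((List.finRange n).flatMap fun i => (List.finRange n).map fun j => f i j) ++ l').getD
      (u * n + v) 0 = f u v := by
  rw [getD_flatMap _ (n := n) (by simp) _ _ _ (by simp) v.2]
  simp [List.getD_eq_getElem?_getD]

theorem hasInput_initial (I : CCInstance) : HasInput I (initial I.code) where
  n_eq := by simp [initial, code]
  k_eq := by simp [initial, code]
  weight_eq u v := by
    -- The offset `3` skips the length of the list, the number of vertices and the budget.
    rw [initial, if_pos rfl, add_comm 3]
    simp only [code, List.getD_cons_succ]
    exact getD_flatMap_finRange (fun i j => I.weight s(i, j)) u v _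
  adj_iff u v := by
    classical
    rw [initial, if_pos rfl, add_comm 3]
    simp only [code, List.getD_cons_succ]
    have hlen : (((List.finRange I.n).flatMap fun i => (List.finRange I.n).map fun j =>
        I.weight s(i, j))).length = I.n * I.n := by
      simp [List.length_flatMap]
    rw [List.getD_append_right _ _ _ _ (by rw [hlen]; omega), hlen, Nat.add_sub_cancel_left,
      ← List.append_nil (List.flatMap _ _),
      getD_flatMap_finRange (fun i j => if I.graph.real.Adj i j then 1 else 0) u v]
    split_ifs with h <;> simp [h]

theorem initial_of_ne_zero (l : List ℕ) {b : ℕ} (hb : b ≠ 0) (i : ℕ) : initial l b i = 0 := by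
  rw [initial, if_neg hb]

theorem n_le_bitSize_code (I : CCInstance) : I.n ≤ bitSize I.code := by
  have h : I.code.length ≤ bitSize I.code := by
    unfold bitSize
    simpa only [List.length_map] using
      List.length_le_sum_of_one_le (I.code.map fun x => x.size + 1) (by simp)
  rw [length_code] at h
  nlinarith

/-! ### The kernelization. -/

def kernelProg : Prog :=
  .seq rowsProg (.seq realProg (.seq warshallProg (.seq dirtyProg (.seq repProg (.seq listProg
    (.seq peelProg (.seq totalProg (.seq boundProg outputProg))))))))

/-- `J` is the result of the kernelization of `I`. -/
def IsReduction (I J : CCInstance) : Prop :=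
  ∃ (m : ℕ) (M : Merging I m) (q : ℕ), q ≤ I.d ∧ I.SparseFuzzy q ∧
    ((M.total / 2 ≤ I.k ∧ m ≤ min I.k I.n * (16 * q + 4 * min I.k I.n + 8) ∧ J = M.merged) ∨
      (¬ (M.total / 2 ≤ I.k ∧ m ≤ min I.k I.n * (16 * q + 4 * min I.k I.n + 8)) ∧ J = no))

theorem wp_kernelProg (I : CCInstance) {N : ℕ} (hN : I.n ≤ N) :
    WP N kernelProg (fun s => ∃ J, IsReduction I J ∧ output s = J.code) (initial I.code) := by
  have h₀ := I.hasInput_initial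
  have hz := fun b (hb : b ≠ 0) => initial_of_ne_zero I.code hb
  set s₀ := initial I.code
  refine WP.seq ((wp_rowsProg hN h₀ (hz 2 (by decide) 0)).mono fun s₁ hf₁ h₁ => ?_)
  refine WP.seq ((wp_realProg hN h₁).mono fun s₂ hf₂ h₂ => ?_)
  have hr₂ := h₁.congr (hf₂ 0 (by decide)) (hf₂ 2 (by decide))
  refine WP.seq ((wp_warshallProg hN hr₂ h₂).mono fun s₃ hf₃ h₃ => ?_)
  have hr₃ := hr₂.congr (hf₃ 0 (by decide)) (hf₃ 2 (by decide))
  refine WP.seq ((wp_dirtyProg hN hr₃ h₃).mono fun s₄ hf₄ h₄ => ?_)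
  have hr₄ := hr₃.congr (hf₄ 0 (by decide)) (hf₄ 2 (by decide))
  refine WP.seq ((wp_repProg hN hr₄).mono fun s₅ hf₅ h₅ => ?_)
  have hr₅ := hr₄.congr (hf₅ 0 (by decide)) (hf₅ 2 (by decide))
  have hz₅ : ∀ b ∈ [1, 6, 7, 8, 9, 12, 13], s₅ b = s₀ b := by
    intro b hb
    simp only [List.mem_cons, List.not_mem_nil, or_false] at hb
    rcases hb with rfl | rfl | rfl | rfl | rfl | rfl | rfl <;>
      rw [hf₅ _ (by decide), hf₄ _ (by decide), hf₃ _ (by decide), hf₂ _ (by decide),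
        hf₁ _ (by decide)]
  refine WP.seq ((wp_listProg hN hr₅ (by rw [hz₅ 7 (by decide), hz 7 (by decide)])).mono ?_)
  rintro s₆ hf₆ ⟨l, hl₁, hl₂, hl₃⟩
  have hr₆ := hr₅.congr (hf₆ 0 (by decide)) (hf₆ 2 (by decide))
  obtain ⟨M, hM₆⟩ := exists_stores hr₆
    (by rw [hf₆ 4 (by decide), hf₅ 4 (by decide)]; exact h₄)
    (h₅.congr_state fun v _ => by rw [hf₆ 5 (by decide)]) hl₁
    (by rw [hf₆ 4 (by decide), hf₆ 5 (by decide)]; exact hl₂) hl₃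
  refine WP.seq ((wp_peelProg hN hr₆
    (fun i => by rw [hf₆ 8 (by decide), hz₅ 8 (by decide), hz 8 (by decide)])
    (by rw [hf₆ 9 (by decide), hz₅ 9 (by decide), hz 9 (by decide)])).mono ?_)
  rintro s₇ hf₇ ⟨hq, hsparse⟩
  have hM₇ : Stores M s₇ := by apply hM₆.congr <;> exact hf₇ _ (by decide)
  refine WP.seq ((wp_totalProg hN hM₇ (by
    rw [hf₇ 12 (by decide), hf₆ 12 (by decide), hz₅ 12 (by decide),
      hz 12 (by decide)])).mono fun s₈ hf₈ h₈ => ?_)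
  have hM₈ : Stores M s₈ := by apply hM₇.congr <;> exact hf₈ _ (by decide)
  refine WP.seq ((wp_boundProg hN hM₈.toHasRows (by
    rw [hf₈ 13 (by decide), hf₇ 13 (by decide), hf₆ 13 (by decide), hz₅ 13 (by decide),
      hz 13 (by decide)])).mono fun s₉ hf₉ h₉ => ?_)
  have hM₉ : Stores M s₉ := by apply hM₈.congr <;> exact hf₉ _ (by decide)
  have ho : output s₉ = [] := by
    have : s₉ 1 = s₀ 1 := by
      rw [hf₉ 1 (by decide), hf₈ 1 (by decide), hf₇ 1 (by decide), hf₆ 1 (by decide),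
        hz₅ 1 (by decide)]
    unfold output
    rw [this, hz 1 (by decide) 0]
    rfl
  refine (wp_outputProg hN hM₉ ho (by rw [hf₉ 12 (by decide), h₈])).mono fun s _ hs => ?_
  rw [h₉, hf₈ 9 (by decide)] at hs
  rcases hs with ⟨h1, h2, h3⟩ | ⟨h1, h3⟩
  · exact ⟨M.merged, ⟨_, M, s₇ 9 0, hq, hsparse, Or.inl ⟨h1, h2, rfl⟩⟩, h3⟩
  · exact ⟨no, ⟨_, M, s₇ 9 0, hq, hsparse, Or.inr ⟨h1, rfl⟩⟩, h3⟩

theorem IsReduction.isYes_iff {I J : CCInstance} (h : IsReduction I J) : J.IsYes ↔ I.IsYes := by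
  obtain ⟨m, M, q, _, hsparse, ⟨hk, _, rfl⟩ | ⟨hno, rfl⟩⟩ := h
  · exact ⟨M.isYes_of_merged_isYes hk, fun h => (M.merged_isYes_of_isYes h).2⟩
  · refine ⟨fun h => absurd h not_isYes_no, fun h => absurd ⟨(M.merged_isYes_of_isYes h).1, ?_⟩ hno⟩
    have h1 := M.card_le_of_isYes h q hsparse
    rcases le_total I.k I.n with hkn | hkn
    · rw [min_eq_left hkn]
      calc m ≤ _ := h1
        _ = _ := by ring
    -- If `n ≤ k`, the bound computed with `n` in place of `k` is at least `n ≥ m`, so the size test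
    -- cannot fail.
    · rw [min_eq_right hkn]
      have := M.m_le
      nlinarith

/-- A bound for the number of vertices of the kernel. -/
theorem IsReduction.n_le {I J : CCInstance} (h : IsReduction I J) :
    J.n ≤ 3 ∨ J.n ≤ I.k * (16 * I.d + 4 * I.k + 8) := by
  obtain ⟨m, M, q, hq, _, ⟨_, hm, rfl⟩ | ⟨_, rfl⟩⟩ := h
  · right
    refine le_trans (b := m) le_rfl (hm.trans ?_)
    have := min_le_left I.k I.n
    gcongr
  · exact Or.inl le_rfl

theorem IsReduction.k_le {I J : CCInstance} (h : IsReduction I J) : J.k ≤ I.k := by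
  obtain ⟨m, M, q, hq, _, ⟨_, hm, rfl⟩ | ⟨_, rfl⟩⟩ := h
  · exact Nat.sub_le _ _
  · exact Nat.zero_le _

theorem IsReduction.weight_le {I J : CCInstance} (h : IsReduction I J) (u v : Fin J.n) :
    J.weight s(u, v) ≤ 2 * I.k + 1 := by
  obtain ⟨m, M, q, hq, _, ⟨_, hm, rfl⟩ | ⟨_, rfl⟩⟩ := h
  · rw [M.merged_weight u v]
    split_ifs
    · omega
    · exact (min_le_right _ _).trans (by omega)
  · change (if u = v then 0 else 1) ≤ _
    split_ifs <;> omega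

end CCInstance

/-- Correlation Clustering parameterized by `k + d` has a polynomial kernel with at most `30 k³ d`
vertices (for `k, d ≥ 1`). -/
theorem theorem1 :
    ∃ f : CCInstance → CCInstance,
      IsPolynomialKernel CCInstance.code CCInstance.IsYes CCInstance.param f ∧
        ∀ I : CCInstance, 1 ≤ I.k → 1 ≤ I.d → (f I).n ≤ 30 * I.k ^ 3 * I.d := by
  have key : ∀ I : CCInstance, ∃ J, CCInstance.IsReduction I J ∧ ∃ s t,
      RAM.Exec CCInstance.kernelProg (RAM.initial I.code) s t ∧
        t ≤ CCInstance.kernelProg.timeBound.eval (RAM.bitSize I.code) ∧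
        RAM.output s = J.code := by
    intro I
    obtain ⟨s, t, hx, ht, J, hJ, ho⟩ := I.wp_kernelProg I.n_le_bitSize_code
    exact ⟨J, hJ, s, t, hx, ht, ho⟩
  choose f hf s t hx ht ho using key
  refine ⟨f, ⟨⟨_, _, fun I => ⟨s I, t I, hx I, ht I, ho I⟩⟩, fun I => (hf I).isYes_iff, ?_⟩, ?_⟩
  -- One bound for all data of the kernel: the product covers the number of merged vertices, and `2X
  -- + 4` covers the three vertices of `no`, the budget and the capped weights.
  · let c : Polynomial ℕ := .X * (16 * .X + 4 * .X + 8) + 2 * .X + 4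
    refine ⟨(2 + 2 * c ^ 2) * (c + 1) + 2 * c, fun I => ?_⟩
    have hc : c.eval I.param = I.param * (16 * I.param + 4 * I.param + 8) + 2 * I.param + 4 := by
      simp [c]
    have hk : I.k ≤ I.param := Nat.le_add_right _ _
    have hd : I.d ≤ I.param := Nat.le_add_left _ _
    have h1 : I.k * (16 * I.d + 4 * I.k + 8) ≤
        I.param * (16 * I.param + 4 * I.param + 8) := by gcongr
    have h2 := (f I).bitSize_code_add_param_le (c.eval I.param)
      (by rcases (hf I).n_le with h | h <;> omega) (by have := (hf I).k_le; omega) (by omega)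
      (fun u v => by have := (hf I).weight_le u v; omega)
    refine h2.trans (le_of_eq ?_)
    simp
  · intro I hk hd
    rcases (hf I).n_le with h | h
    · have : 1 ≤ I.k ^ 3 * I.d := Nat.mul_pos (pow_pos hk 3) hd
      nlinarith
    · refine h.trans ?_
      -- The summands `16kd`, `4k²` and `8k` are at most `16`, `4` and `8` times `k³d`, which gives
      -- `28k³d` in total.
      have h2 : I.k ≤ I.k ^ 3 := Nat.le_self_pow (by decide) _
      have h3 : I.k * I.k ≤ I.k ^ 3 := by
        rw [← pow_two]
        exact Nat.pow_le_pow_right hk (by decide)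
      have h4 : I.k * I.d ≤ I.k ^ 3 * I.d := Nat.mul_le_mul_right _ h2
      have h5 : I.k ^ 3 ≤ I.k ^ 3 * I.d := Nat.le_mul_of_pos_right _ hd
      nlinarith
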